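/- Let $n\in\mathbb Z$ and $\lambda>0$ with $\lambda\ge 2n^2$. For $f,a:[0,\infty)\to\mathbb R$ define the radial magnetic Ginzburg--Landau energy $$E_r^{(n)}(f,a)=\frac12\int_0^\infty\Big\{(f')^2+n^2\frac{(1-a)^2f^2}{r^2}+n^2\frac{(a')^2}{r^2}+\frac{\lambda}{4}(f^2-1)^2\Big\}\,r\,dr\ \in[0,\infty],$$ and let $\mathcal C$ be the class of pairs $(f,a)$ (locally absolutely continuous on $(0,\infty)$, i.e. with weak derivatives $f',a'\in L^1_{loc}(0,\infty)$) such that $1-f\in H^1(r\,dr)$ (that is, $1-f,\ f'\in L^2((0,\infty),r\,dr)$), $\frac ar\in L^2((0,R),r\,dr)$ for every $R>0$, and $\frac{a'}{r}\in L^2((0,\infty),r\,dr)$. Let $(f,a)\in\mathcal C$ be a $C^2$ solution on $(0,\infty)$ of the $n$-vortex equations $$-f''-\frac{f'}{r}+\frac{n^2(1-a)^2}{r^2}f+\frac\lambda2(f^2-1)f=0,\qquad -a''+\frac{a'}{r}-f^2(1-a)=0 .$$ Then $(f,a)$ minimizes $E_r^{(n)}$ over $\mathcal C$: $E_r^{(n)}(f,a)\le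 E_r^{(n)}(g,c)$ for all $(g,c)\in\mathcal C$. -/

import Mathlib

open MeasureTheory Set
open scoped ENNReal

noncomputable section

namespace GinzburgLandau

/-- The measure `r dr` on `(0, ∞)`. -/
def radialMeasure : Measure ℝ :=
  (volume.restrict (Ioi 0)).withDensity fun r => ENNReal.ofReal r

/-- Local absolute continuity on `(0, ∞)`. In one dimension this is the same as possessing a locally
integrable weak derivative (for the continuous representative), and that weak derivative is the
almost everywhere defined classical derivative `deriv u`. -/
def LocallyAC (u : ℝ → ℝ) : Prop :=
  ∀ x y : ℝ, 0 < x → x ≤ y → AbsolutelyContinuousOnInterval u x y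

/-- Membership in `H¹(r dr)`: `u` and its weak derivative lie in `L²(r dr)`. -/
def MemH1 (u : ℝ → ℝ) : Prop :=
  LocallyAC u ∧ MemLp u 2 radialMeasure ∧ MemLp (deriv u) 2 radialMeasure

/-- Membership in `L²_loc(r dr)` on the closed half-line `[0, ∞)` (square integrability on `(0, R]`
for every `R`, so in particular up to the origin). -/
def MemL2Loc (u : ℝ → ℝ) : Prop :=
  ∀ R : ℝ, 0 < R → MemLp u 2 (radialMeasure.restrict (Ioc 0 R))

/-- The class of radial profiles `(f, a)` with `1 - f ∈ H¹(r dr)`, `a / r ∈ L²_loc(r dr)` and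
`a' / r ∈ L²(r dr)`. Profiles are functions on `ℝ` of which only the values on `(0, ∞)` matter. -/
def radialClass : Set ((ℝ → ℝ) × (ℝ → ℝ)) :=
  {u | MemH1 (fun r => 1 - u.1 r) ∧ LocallyAC u.2 ∧
    MemL2Loc (fun r => u.2 r / r) ∧ MemLp (fun r => deriv u.2 r / r) 2 radialMeasure}

/-- The radial energy `E_r^{(n)}(f, a)` with coupling constant `lam`, with values in `[0, ∞]`. The
integrand is non-negative for `lam > 0`, so nothing is lost by `ENNReal.ofReal`. -/
def radialEnergy (n : ℤ) (lam : ℝ) (f a : ℝ → ℝ) : ℝ≥0∞ :=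
  (1 / 2) * ∫⁻ r, ENNReal.ofReal
    ((deriv f r) ^ 2 + (n : ℝ) ^ 2 * ((1 - a r) ^ 2 * (f r) ^ 2 / r ^ 2)
      + (n : ℝ) ^ 2 * ((deriv a r) ^ 2 / r ^ 2) + lam / 4 * ((f r) ^ 2 - 1) ^ 2) ∂radialMeasure

/-- The radial Laplacian `Δ_r u = u'' + u' / r`. -/
def radialLaplacian (u : ℝ → ℝ) (r : ℝ) : ℝ :=
  deriv (deriv u) r + deriv u r / r

/-- `(f, a)` is a classical solution on `(0, ∞)` of the `n`-vortex equations. -/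
structure SolvesVortexODE (n : ℤ) (lam : ℝ) (f a : ℝ → ℝ) : Prop where
  contDiffOn_f : ContDiffOn ℝ 2 f (Ioi 0)
  contDiffOn_a : ContDiffOn ℝ 2 a (Ioi 0)
  eq_f : ∀ r : ℝ, 0 < r →
    -radialLaplacian f r + (n : ℝ) ^ 2 * (1 - a r) ^ 2 / r ^ 2 * f r
      + lam / 2 * ((f r) ^ 2 - 1) * f r = 0
  eq_a : ∀ r : ℝ, 0 < r →
    -deriv (deriv a) r + deriv a r / r - (f r) ^ 2 * (1 - a r) = 0

end GinzburgLandau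

end

/-! The proof is a calibration by scaling. Write `b = 1 - a` and `N = n ^ 2`. For `N ≥ 1` the
profile is strictly monotone: `f` increases from 0 to 1 and `b` decreases from 1 to 0
(`strictMonoOn_f`, `strictAntiOn_b` and the limit lemmas). Hence `r f'` is a continuous function `p`
of `f`, and `r b'` a continuous function `q` of `b`; these are the slopes of the foliation by the
rescalings of the profile (`exists_isCalibration`).

For a competitor `(g, d)`, completing the squares in `g'` and `d'` around the slopes `p(|g|) / r`
and `q(d) / r` writes the energy density as two squares, plus an exact derivative
(`nullLagrangian`), plus `reducedDensity / r`, which contains no derivatives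
(`hasDerivAt_nullLagrangian`). The squares vanish on the vortex. The heart of the matter is
`reducedDensity_le`: at each fixed `r` the reduced density, as a function of two real variables, is
minimal at `(f r, b r)`. In the coordinates `(f y, b z)` the vortex equations make its partial
derivatives explicit, with signs that can be read off along paths starting from `y = z = r`.

The boundary contributions are made small in the direction needed, along suitable radii tending to 0
and infinity (`exists_integral_energyDensity_le`). For `n = 0` a Pohozaev identity forces `f ^ 2 =
1`, so the energy is zero. -/

noncomputable section
namespace GinzburgLandau
open Filter Topology

/-! ### Analytic tools: weighted square integrability, linear ODE uniqueness, factoring through a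
monotone function. -/

/-- A function that is square integrable for `r dr` near the origin satisfies `r |φ r| < ε` at
arbitrarily small `r`. -/
lemma exists_mul_abs_lt_near_zero {φ : ℝ → ℝ} {R : ℝ} (hR : 0 < R)
    (h : IntegrableOn (fun r => φ r ^ 2 * r) (Ioc 0 R)) {ε δ : ℝ} (hε : 0 < ε) (hδ : 0 < δ) :
    ∃ r, 0 < r ∧ r < δ ∧ r * |φ r| < ε := by
  by_contra! hc
  set d := min (δ / 2) R
  have hd : 0 < d := lt_min (by positivity) hR
  -- If the claim failed, `φ ^ 2 * r ≥ ε ^ 2 / r` near 0, and `1 / r` would be integrable there.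
  have h1 : IntegrableOn (fun r : ℝ => r⁻¹) (Ioc 0 d) := by
    have h2 : IntegrableOn (fun r => (ε ^ 2)⁻¹ * (φ r ^ 2 * r)) (Ioc 0 d) :=
      (h.mono_set (Ioc_subset_Ioc_right (min_le_right _ _))).const_mul _
    refine Integrable.mono' h2 measurable_inv.aestronglyMeasurable ?_
    refine (ae_restrict_iff' measurableSet_Ioc).2 (ae_of_all _ fun r hr => ?_)
    have hr0 : 0 < r := hr.1
    have hrd : r < δ := lt_of_le_of_lt (hr.2.trans (min_le_left _ _)) (by linarith)
    have h3 := hc r hr0 hrd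
    have h4 : ε ^ 2 ≤ r ^ 2 * φ r ^ 2 := by
      calc ε ^ 2 ≤ (r * |φ r|) ^ 2 := by gcongr
        _ = r ^ 2 * φ r ^ 2 := by rw [mul_pow, sq_abs]
    rw [Real.norm_of_nonneg (by positivity), inv_mul_eq_div, inv_eq_one_div,
      div_le_div_iff₀ hr0 (by positivity)]
    nlinarith
  have h5 : IntervalIntegrable (fun r : ℝ => r⁻¹) volume 0 d :=
    (intervalIntegrable_iff_integrableOn_Ioc_of_le hd.le).2 h1
  rw [intervalIntegrable_inv_iff] at h5
  rcases h5 with h5 | h5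
  · exact hd.ne h5
  · exact h5 left_mem_uIcc

/-- A function that is square integrable for `r dr` satisfies `r |φ r| < ε` at arbitrarily
large `r`. -/
lemma exists_mul_abs_lt_at_top {φ : ℝ → ℝ} {a : ℝ}
    (h : IntegrableOn (fun r => φ r ^ 2 * r) (Ioi a)) {ε : ℝ} (R : ℝ) (hε : 0 < ε) :
    ∃ r, R < r ∧ r * |φ r| < ε := by
  by_contra! hc
  set d := max (max R a) 1
  have hd1 : 1 ≤ d := le_max_right _ _
  have h1 : IntegrableOn (fun r : ℝ => r⁻¹) (Ioi d) := by
    have h2 : IntegrableOn (fun r => (ε ^ 2)⁻¹ * (φ r ^ 2 * r)) (Ioi d) :=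
      (h.mono_set (Ioi_subset_Ioi ((le_max_right _ _).trans (le_max_left _ _)))).const_mul _
    refine Integrable.mono' h2 measurable_inv.aestronglyMeasurable ?_
    refine (ae_restrict_iff' measurableSet_Ioi).2 (ae_of_all _ fun r hr => ?_)
    have hr0 : 0 < r := lt_of_lt_of_le one_pos (hd1.trans (le_of_lt hr))
    have h3 := hc r (lt_of_le_of_lt ((le_max_left _ _).trans (le_max_left _ _)) hr)
    have h4 : ε ^ 2 ≤ r ^ 2 * φ r ^ 2 := by
      calc ε ^ 2 ≤ (r * |φ r|) ^ 2 := by gcongr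
        _ = r ^ 2 * φ r ^ 2 := by rw [mul_pow, sq_abs]
    rw [Real.norm_of_nonneg (by positivity), inv_mul_eq_div, inv_eq_one_div,
      div_le_div_iff₀ hr0 (by positivity)]
    nlinarith
  exact not_integrableOn_Ioi_inv h1

lemma _root_.AbsolutelyContinuousOnInterval.lipschitz_comp {H u : ℝ → ℝ} {K : NNReal} {x y : ℝ}
    (hH : LipschitzWith K H) (hu : AbsolutelyContinuousOnInterval u x y) :
    AbsolutelyContinuousOnInterval (fun r => H (u r)) x y := by
  unfold AbsolutelyContinuousOnInterval at *
  refine squeeze_zero (fun t => Finset.sum_nonneg fun i _ => dist_nonneg) (fun t => ?_)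
    (by simpa using hu.const_mul (K : ℝ))
  rw [Finset.mul_sum]
  exact Finset.sum_le_sum fun i _ => hH.dist_le_mul _ _

/-- A Cauchy–Schwarz (Young) bound for the oscillation of `c` by `∫ c'² / t`. -/
lemma abs_sub_le_of_integral_le {c : ℝ → ℝ} (hc : LocallyAC c)
    {η ε s r : ℝ} (hs : 0 < s) (hsr : s ≤ r) (hε : 0 < ε)
    (hi : IntegrableOn (fun t => (deriv c t / t) ^ 2 * t) (Ioc 0 r))
    (hη : ∫ t in Ioc 0 r, (deriv c t / t) ^ 2 * t ≤ η) :
    |c r - c s| ≤ r * (η / ε + ε) := by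
  have hr : 0 < r := hs.trans_le hsr
  have hAC := hc s r hs hsr
  have hi' : IntervalIntegrable (fun t => (deriv c t / t) ^ 2 * t) volume s r :=
    (intervalIntegrable_iff_integrableOn_Ioc_of_le hsr).2
      (hi.mono_set (Ioc_subset_Ioc_left hs.le))
  have hle : ∫ t in s..r, (deriv c t / t) ^ 2 * t ≤ η := by
    rw [intervalIntegral.integral_of_le hsr]
    refine le_trans (setIntegral_mono_set hi ?_ (Ioc_subset_Ioc_left hs.le).eventuallyLE) hη
    refine (ae_restrict_iff' measurableSet_Ioc).2 (ae_of_all _ fun t ht => ?_)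
    have : 0 < t := ht.1
    simp only [Pi.zero_apply]; positivity
  have hη0 : 0 ≤ η := by
    refine le_trans (intervalIntegral.integral_nonneg hsr fun t ht => ?_) hle
    have : 0 < t := hs.trans_le ht.1
    positivity
  rw [← hAC.integral_deriv_eq_sub]
  have h1 : |∫ t in s..r, deriv c t| ≤
      ∫ t in s..r, (r / ε * ((deriv c t / t) ^ 2 * t) + ε) := by
    rw [← Real.norm_eq_abs]
    refine intervalIntegral.norm_integral_le_of_norm_le hsr (ae_of_all _ fun t ht => ?_)
      ((hi'.const_mul _).add intervalIntegrable_const)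
    have ht0 : 0 < t := hs.trans ht.1
    have htr : t ≤ r := ht.2
    rw [Real.norm_eq_abs]
    set w := |deriv c t| with hw
    have hw0 : 0 ≤ w := abs_nonneg _
    have e1 : (deriv c t / t) ^ 2 * t = w ^ 2 / t := by
      rw [hw, sq_abs]; field_simp
    rw [e1]
    have e2 : w ^ 2 / ε ≤ r / ε * (w ^ 2 / t) := by
      rw [div_mul_div_comm, div_le_div_iff₀ hε (by positivity)]
      nlinarith [mul_nonneg (sq_nonneg w) hε.le, mul_le_mul_of_nonneg_left htr
        (mul_nonneg (sq_nonneg w) hε.le)]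
    have e3 : w ≤ w ^ 2 / ε + ε := by
      have : w ^ 2 / ε + ε - w = ((w - ε / 2) ^ 2 + 3 / 4 * ε ^ 2) / ε := by field_simp; ring
      have : 0 ≤ w ^ 2 / ε + ε - w := by rw [this]; positivity
      linarith
    linarith
  refine h1.trans ?_
  rw [intervalIntegral.integral_add (hi'.const_mul _) intervalIntegrable_const,
    intervalIntegral.integral_const_mul, intervalIntegral.integral_const, smul_eq_mul]
  have h2 : r / ε * (∫ t in s..r, (deriv c t / t) ^ 2 * t) ≤ r / ε * η := by gcongr
  have h3 : (r - s) * ε ≤ r * ε := by gcongr; linarith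
  calc _ ≤ r / ε * η + r * ε := add_le_add h2 h3
    _ = r * (η / ε + ε) := by ring

/-- `c / r → 0` at the origin when `c / r ∈ L²_loc(r dr)` and `c' / r ∈ L²(r dr)`. -/
lemma eventually_abs_le_mul {c : ℝ → ℝ} (hc : LocallyAC c)
    (h0 : IntegrableOn (fun t => (c t / t) ^ 2 * t) (Ioc 0 1))
    (h1 : IntegrableOn (fun t => (deriv c t / t) ^ 2 * t) (Ioi 0)) {ε : ℝ} (hε : 0 < ε) :
    ∃ δ > 0, ∀ r, 0 < r → r < δ → |c r| ≤ ε * r := by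
  have hint : IntervalIntegrable (fun t => (deriv c t / t) ^ 2 * t) volume 0 1 :=
    (intervalIntegrable_iff_integrableOn_Ioc_of_le zero_le_one).2
      (h1.mono_set Ioc_subset_Ioi_self)
  have hcont := intervalIntegral.continuousOn_primitive_interval' hint
    (left_mem_uIcc : (0 : ℝ) ∈ uIcc 0 1)
  have h2 := hcont 0 left_mem_uIcc
  rw [ContinuousWithinAt, intervalIntegral.integral_same, uIcc_of_le zero_le_one,
    Metric.tendsto_nhdsWithin_nhds] at h2
  -- With `η = (ε / 4) ^ 2` and Young parameter `ε / 4`, the oscillation of `c` on `[s, r]` is at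
  -- most `ε r / 2`; then `s` is chosen with `c s` arbitrarily small.
  obtain ⟨δ, hδ, h3⟩ := h2 ((ε / 4) ^ 2) (by positivity)
  refine ⟨min δ 1, lt_min hδ one_pos, fun r hr hrδ => ?_⟩
  have hr1 : r < 1 := hrδ.trans_le (min_le_right _ _)
  have h4 := h3 (show r ∈ Icc 0 1 from ⟨hr.le, hr1.le⟩)
    (by rw [dist_zero_right, Real.norm_of_nonneg hr.le]; exact hrδ.trans_le (min_le_left _ _))
  rw [dist_zero_right, intervalIntegral.integral_of_le hr.le] at h4
  have h5 := (le_abs_self _).trans h4.le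
  refine le_of_forall_pos_le_add fun θ hθ => ?_
  obtain ⟨s, hs, hsr, hsc⟩ := exists_mul_abs_lt_near_zero one_pos h0 hθ hr
  rw [abs_div, abs_of_pos hs, mul_div_cancel₀ _ hs.ne'] at hsc
  have h6 := abs_sub_le_of_integral_le hc hs hsr.le (show 0 < ε / 4 by positivity)
    (h1.mono_set Ioc_subset_Ioi_self) h5
  have h7 : r * ((ε / 4) ^ 2 / (ε / 4) + ε / 4) ≤ ε * r := by
    have : (ε / 4) ^ 2 / (ε / 4) = ε / 4 := by field_simp
    rw [this]; nlinarith [mul_pos hε hr]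
  have h8 : |c r| ≤ |c r - c s| + |c s| := by
    simpa using abs_add_le (c r - c s) (c s)
  linarith

/-- Uniqueness for linear second order equations on `(0, ∞)`. -/
lemma eq_zero_of_linear_ode {u v A B : ℝ → ℝ}
    (hu : ∀ r, 0 < r → HasDerivAt u (v r) r)
    (hv : ∀ r, 0 < r → HasDerivAt v (A r * u r + B r * v r) r)
    (hA : ContinuousOn A (Ioi 0)) (hB : ContinuousOn B (Ioi 0))
    {r₀ : ℝ} (hr₀ : 0 < r₀) (h0 : u r₀ = 0) (h1 : v r₀ = 0) {r : ℝ} (hr : 0 < r) : u r = 0 := by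
  set x := min r₀ r / 2 with hx
  set y := max r₀ r + 1 with hy
  have hm : 0 < min r₀ r := lt_min hr₀ hr
  have hx0 : 0 < x := by positivity
  have hsub : Icc x y ⊆ Ioi 0 := fun t ht => hx0.trans_le ht.1
  obtain ⟨CA, hCA⟩ := isCompact_Icc.exists_bound_of_continuousOn (hA.mono hsub)
  obtain ⟨CB, hCB⟩ := isCompact_Icc.exists_bound_of_continuousOn (hB.mono hsub)
  have m1 := min_le_left r₀ r
  have m2 := min_le_right r₀ r
  have m3 := le_max_left r₀ r
  have m4 := le_max_right r₀ r
  have mem0 : r₀ ∈ Ioo x y := ⟨by linarith, by linarith⟩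
  have mem1 : r ∈ Ioo x y := ⟨by linarith, by linarith⟩
  have hCA0 : 0 ≤ CA := (norm_nonneg _).trans (hCA r₀ (Ioo_subset_Icc_self mem0))
  have hCB0 : 0 ≤ CB := (norm_nonneg _).trans (hCB r₀ (Ioo_subset_Icc_self mem0))
  have key := ODE_solution_unique_of_mem_Ioo (E := ℝ × ℝ) (K := (1 + CA + CB).toNNReal)
    (v := fun t z => (z.2, A t * z.1 + B t * z.2)) (s := fun _ => univ)
    (f := fun t => (u t, v t)) (g := fun _ => (0, 0)) (a := x) (b := y) (t₀ := r₀)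
    (fun t ht => ?_) mem0 (fun t ht => ⟨?_, mem_univ _⟩) (fun t ht => ⟨?_, mem_univ _⟩)
    (by simp [h0, h1]) mem1
  · exact congrArg Prod.fst key
  · rw [lipschitzOnWith_univ]
    refine LipschitzWith.of_dist_le_mul fun z w => ?_
    have a1 := hCA t (Ioo_subset_Icc_self ht)
    have a2 := hCB t (Ioo_subset_Icc_self ht)
    rw [Real.coe_toNNReal _ (by positivity), dist_eq_norm, dist_eq_norm]
    have b1 : ‖(z - w).1‖ ≤ ‖z - w‖ := norm_fst_le _
    have b2 : ‖(z - w).2‖ ≤ ‖z - w‖ := norm_snd_le _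
    have b0 := norm_nonneg (z - w)
    rw [Prod.norm_def]
    refine max_le ?_ ?_
    · calc _ ≤ ‖z - w‖ := b2
        _ ≤ _ := by nlinarith
    · have e : (((z.2, A t * z.1 + B t * z.2) : ℝ × ℝ) - (w.2, A t * w.1 + B t * w.2)).2
          = A t * (z - w).1 + B t * (z - w).2 := by simp; ring
      rw [e]
      calc _ ≤ ‖A t‖ * ‖(z - w).1‖ + ‖B t‖ * ‖(z - w).2‖ := by
            rw [← norm_mul, ← norm_mul]; exact norm_add_le _ _
        _ ≤ CA * ‖z - w‖ + CB * ‖z - w‖ := by gcongr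
        _ ≤ _ := by nlinarith
  · exact (hu t (hx0.trans ht.1)).prodMk (hv t (hx0.trans ht.1))
  · exact (hasDerivAt_const t ((0, 0) : ℝ × ℝ)).congr_deriv (by simp; rfl)

/-- An increasing bijection `φ` of `(0, ∞)` onto `(0, 1)` factors every continuous `ψ` vanishing at
both ends through a continuous function of `φ` supported in `[0, 1]`. -/
lemma exists_continuous_factor {φ ψ : ℝ → ℝ} (hmono : StrictMonoOn φ (Ioi 0))
    (hφ : ContinuousOn φ (Ioi 0)) (h01 : ∀ r, 0 < r → φ r ∈ Ioo (0 : ℝ) 1)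
    (h0 : Tendsto φ (𝓝[>] 0) (𝓝 0)) (h1 : Tendsto φ atTop (𝓝 1))
    (hψ : ContinuousOn ψ (Ioi 0)) (hψ0 : Tendsto ψ (𝓝[>] 0) (𝓝 0))
    (hψ1 : Tendsto ψ atTop (𝓝 0)) :
    (∀ t ∈ Ioo (0 : ℝ) 1, ∃ r, 0 < r ∧ φ r = t) ∧
    ∃ p : ℝ → ℝ, Continuous p ∧ (∀ r, 0 < r → p (φ r) = ψ r) ∧
      ∀ t, t ∉ Ioo (0 : ℝ) 1 → p t = 0 := by
  classical
  have hsurj : ∀ t ∈ Ioo (0 : ℝ) 1, ∃ r, 0 < r ∧ φ r = t := by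
    intro t ht
    obtain ⟨x, hx, hx0⟩ := ((h0.eventually (gt_mem_nhds ht.1)).and self_mem_nhdsWithin).exists
    obtain ⟨y, hy, hy0⟩ := ((h1.eventually (lt_mem_nhds ht.2)).and (eventually_gt_atTop x)).exists
    have hx0' : (0 : ℝ) < x := hx0
    obtain ⟨r, hr, hr'⟩ := intermediate_value_Icc hy0.le
      (hφ.mono fun z hz => lt_of_lt_of_le hx0' hz.1) (show t ∈ Icc (φ x) (φ y) from ⟨hx.le, hy.le⟩)
    exact ⟨r, lt_of_lt_of_le hx0' hr.1, hr'⟩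
  refine ⟨hsurj, ?_⟩
  choose! inv hinv using hsurj
  let p : ℝ → ℝ := fun t => if t ∈ Ioo (0 : ℝ) 1 then ψ (inv t) else 0
  have hp : ∀ r, 0 < r → p (φ r) = ψ r := by
    intro r hr
    have h := hinv _ (h01 r hr)
    simp only [p, if_pos (h01 r hr)]
    rw [hmono.injOn h.1 hr h.2]
  have hp0 : ∀ t, t ∉ Ioo (0 : ℝ) 1 → p t = 0 := fun t ht => if_neg ht
  refine ⟨p, continuous_iff_continuousAt.2 fun t₀ => ?_, hp, hp0⟩
  rw [ContinuousAt, Metric.tendsto_nhds]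
  intro ε hε
  by_cases ht₀ : t₀ ∈ Ioo (0 : ℝ) 1
  · obtain ⟨hr, hr'⟩ := hinv t₀ ht₀
    set r₀ := inv t₀
    have hr0 : 0 < r₀ := hr
    have hc := (hψ.continuousAt (Ioi_mem_nhds hr0)).eventually (Metric.ball_mem_nhds _ hε)
    obtain ⟨δ, hδ, hδ'⟩ := Metric.eventually_nhds_iff.1 hc
    set d := min (δ / 2) (r₀ / 2)
    have hd : 0 < d := lt_min (by positivity) (by positivity)
    have d1 : d ≤ δ / 2 := min_le_left _ _
    have d2 : d ≤ r₀ / 2 := min_le_right _ _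
    have m1 : r₀ - d ∈ Ioi (0 : ℝ) := by simp only [mem_Ioi]; linarith
    have m2 : r₀ + d ∈ Ioi (0 : ℝ) := by simp only [mem_Ioi]; linarith
    have l1 : φ (r₀ - d) < t₀ := by rw [← hr']; exact hmono m1 hr0 (by linarith)
    have l2 : t₀ < φ (r₀ + d) := by rw [← hr']; exact hmono hr0 m2 (by linarith)
    filter_upwards [Ioo_mem_nhds l1 l2, Ioo_mem_nhds ht₀.1 ht₀.2] with t ht ht'
    obtain ⟨hs, hs'⟩ := hinv t ht'
    rw [← hs'] at ht ⊢
    rw [← hr', hp _ hs, hp _ hr0]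
    have g1 := (hmono.lt_iff_lt m1 hs).1 ht.1
    have g2 := (hmono.lt_iff_lt hs m2).1 ht.2
    exact hδ' (by rw [Real.dist_eq, abs_lt]; constructor <;> linarith)
  · rw [hp0 t₀ ht₀]
    rcases le_or_gt t₀ 0 with h | h
    · obtain ⟨x, hx, hx0⟩ := mem_nhdsGT_iff_exists_Ioc_subset.1
        (hψ0.eventually (Metric.ball_mem_nhds 0 hε))
      have hx' : (0 : ℝ) < x := hx
      filter_upwards [Iio_mem_nhds (h.trans_lt (h01 x hx').1)] with t ht
      by_cases ht' : t ∈ Ioo (0 : ℝ) 1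
      · obtain ⟨hs, hs'⟩ := hinv t ht'
        rw [← hs'] at ht ⊢
        rw [hp _ hs]
        exact hx0 ⟨hs, ((hmono.lt_iff_lt hs hx').1 ht).le⟩
      · rw [hp0 t ht', dist_self]; exact hε
    · have h' : 1 ≤ t₀ := by
        by_contra h2; exact ht₀ ⟨h, not_le.1 h2⟩
      obtain ⟨x, hx⟩ := eventually_atTop.1 (hψ1.eventually (Metric.ball_mem_nhds 0 hε))
      have hx' : (0 : ℝ) < max x 1 := lt_max_of_lt_right one_pos
      filter_upwards [Ioi_mem_nhds ((h01 _ hx').2.trans_le h')] with t ht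
      by_cases ht' : t ∈ Ioo (0 : ℝ) 1
      · obtain ⟨hs, hs'⟩ := hinv t ht'
        rw [← hs'] at ht ⊢
        rw [hp _ hs]
        exact hx _ ((le_max_left _ _).trans ((hmono.lt_iff_lt hx' hs).1 ht).le)
      · rw [hp0 t ht', dist_self]; exact hε

lemma monotoneOn_of_hasDerivAt_nonneg {D : Set ℝ} (hD : Convex ℝ D) {g g' : ℝ → ℝ}
    (h : ∀ r ∈ D, HasDerivAt g (g' r) r) (h' : ∀ r ∈ D, 0 ≤ g' r) : MonotoneOn g D :=
  monotoneOn_of_deriv_nonneg hD (fun r hr => (h r hr).continuousAt.continuousWithinAt)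
    (fun r hr => (h r (interior_subset hr)).differentiableAt.differentiableWithinAt)
    fun r hr => by rw [(h r (interior_subset hr)).deriv]; exact h' r (interior_subset hr)

lemma antitoneOn_of_hasDerivAt_nonpos {D : Set ℝ} (hD : Convex ℝ D) {g g' : ℝ → ℝ}
    (h : ∀ r ∈ D, HasDerivAt g (g' r) r) (h' : ∀ r ∈ D, g' r ≤ 0) : AntitoneOn g D :=
  antitoneOn_of_deriv_nonpos hD (fun r hr => (h r hr).continuousAt.continuousWithinAt)
    (fun r hr => (h r (interior_subset hr)).differentiableAt.differentiableWithinAt)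
    fun r hr => by rw [(h r (interior_subset hr)).deriv]; exact h' r (interior_subset hr)

/-! ### The magnetic component: sign, monotonicity and limits of `b`. -/

/-- A vortex profile of finite kinetic and magnetic energy, in terms of `b = 1 - a` and
`N = n ^ 2`. -/
structure IsVortex (N lam : ℝ) (f b : ℝ → ℝ) : Prop where
  df : ∀ r, 0 < r → HasDerivAt f (deriv f r) r
  ddf : ∀ r, 0 < r → HasDerivAt (deriv f)
    (f r * (N * b r ^ 2 / r ^ 2 - lam / 2 * (1 - f r ^ 2)) - deriv f r / r) r
  db : ∀ r, 0 < r → HasDerivAt b (deriv b r) r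
  ddb : ∀ r, 0 < r → HasDerivAt (deriv b) (deriv b r / r + f r ^ 2 * b r) r
  acb : LocallyAC b
  int_df : IntegrableOn (fun r => deriv f r ^ 2 * r) (Ioi 0)
  int_f : IntegrableOn (fun r => (1 - f r) ^ 2 * r) (Ioi 0)
  int_b : IntegrableOn (fun r => ((1 - b r) / r) ^ 2 * r) (Ioc 0 1)
  int_db : IntegrableOn (fun r => (deriv b r / r) ^ 2 * r) (Ioi 0)

lemma LocallyAC.one_sub {u : ℝ → ℝ} (h : LocallyAC u) : LocallyAC fun r => 1 - u r := by
  intro x y hx hxy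
  have h1 : AbsolutelyContinuousOnInterval (fun _ : ℝ => (1 : ℝ)) x y :=
    (LipschitzWith.const (1 : ℝ)).lipschitzOnWith.absolutelyContinuousOnInterval
  exact h1.fun_sub (h x y hx hxy)

namespace IsVortex

variable {N lam : ℝ} {f b : ℝ → ℝ}

lemma continuousOn_f (h : IsVortex N lam f b) : ContinuousOn f (Ioi 0) :=
  fun r hr => (h.df r hr).continuousAt.continuousWithinAt

lemma continuousOn_b (h : IsVortex N lam f b) : ContinuousOn b (Ioi 0) :=
  fun r hr => (h.db r hr).continuousAt.continuousWithinAt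

lemma exists_abs_one_sub_f_lt (h : IsVortex N lam f b) {ε : ℝ} (hε : 0 < ε) (R : ℝ) :
    ∃ r, R < r ∧ |1 - f r| < ε := by
  obtain ⟨r, hr, hr'⟩ := exists_mul_abs_lt_at_top h.int_f (max R 1) hε
  have h1 : 1 < r := (le_max_right _ _).trans_lt hr
  refine ⟨r, (le_max_left _ _).trans_lt hr, ?_⟩
  nlinarith [abs_nonneg (1 - f r)]

lemma eventually_abs_one_sub_b_le (h : IsVortex N lam f b) {ε : ℝ} (hε : 0 < ε) :
    ∃ δ > 0, ∀ r, 0 < r → r < δ → |1 - b r| ≤ ε * r :=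
  eventually_abs_le_mul h.acb.one_sub h.int_b
    (by simpa [deriv_const_sub, neg_div] using h.int_db) hε

lemma tendsto_b_zero (h : IsVortex N lam f b) : Tendsto b (𝓝[>] 0) (𝓝 1) := by
  rw [Metric.tendsto_nhdsWithin_nhds]
  intro ε hε
  obtain ⟨δ, hδ, h1⟩ := h.eventually_abs_one_sub_b_le hε
  refine ⟨min δ 1, lt_min hδ one_pos, fun r hr hrd => ?_⟩
  have hr0 : 0 < r := hr
  rw [dist_zero_right, Real.norm_of_nonneg hr0.le] at hrd
  have h2 := h1 r hr0 (hrd.trans_le (min_le_left _ _))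
  have h3 : r < 1 := hrd.trans_le (min_le_right _ _)
  rw [dist_comm, Real.dist_eq]
  nlinarith

lemma exists_abs_deriv_b_lt (h : IsVortex N lam f b) {ε : ℝ} (hε : 0 < ε) (R : ℝ) :
    ∃ r, R < r ∧ |deriv b r| < ε := by
  obtain ⟨r, hr, hr'⟩ := exists_mul_abs_lt_at_top h.int_db (max R 0) hε
  have h1 : 0 < r := (le_max_right _ _).trans_lt hr
  refine ⟨r, (le_max_left _ _).trans_lt hr, ?_⟩
  rwa [abs_div, abs_of_pos h1, mul_div_cancel₀ _ h1.ne'] at hr'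

lemma exists_abs_b_le (h : IsVortex N lam f b) : ∃ C > 0, ∀ r, 1 ≤ r → |b r| ≤ C * r := by
  set η := ∫ t in Ioi 0, (deriv b t / t) ^ 2 * t
  refine ⟨|η| + 1 + |b 1|, by positivity, fun r hr => ?_⟩
  have h1 := abs_sub_le_of_integral_le h.acb one_pos hr one_pos
    (h.int_db.mono_set Ioc_subset_Ioi_self) (η := η) (by
      refine setIntegral_mono_set h.int_db ?_ Ioc_subset_Ioi_self.eventuallyLE
      refine (ae_restrict_iff' measurableSet_Ioi).2 (ae_of_all _ fun t ht => ?_)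
      have : 0 < t := ht
      simp only [Pi.zero_apply]; positivity)
  have h2 : |b r| ≤ |b r - b 1| + |b 1| := by simpa using abs_add_le (b r - b 1) (b 1)
  have h3 := le_abs_self η
  rw [div_one] at h1
  nlinarith [abs_nonneg (b 1)]

lemma hasDerivAt_deriv_b_div (h : IsVortex N lam f b) {r : ℝ} (hr : 0 < r) :
    HasDerivAt (fun r => deriv b r / r) (f r ^ 2 * b r / r) r := by
  refine ((h.ddb r hr).div (hasDerivAt_id r) hr.ne').congr_deriv ?_
  simp only [id]; field_simp; ring

/-- The equation gives `(b b' / r)' = (b' ^ 2 + f ^ 2 b ^ 2) / r ≥ 0`, so a positive value of `b b'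
/ r` would persist as a lower bound. This contradicts the linear growth bound on `b` at large radii
where `b'` is small. -/
lemma b_mul_deriv_nonpos (h : IsVortex N lam f b) {r : ℝ} (hr : 0 < r) : b r * deriv b r ≤ 0 := by
  have hm : MonotoneOn (fun r => b r * (deriv b r / r)) (Ioi 0) :=
    monotoneOn_of_hasDerivAt_nonneg (convex_Ioi 0)
      (fun s hs => (h.db s hs).mul (h.hasDerivAt_deriv_b_div hs))
      fun s hs => by
        have hs' : 0 < s := hs
        have : deriv b s * (deriv b s / s) + b s * (f s ^ 2 * b s / s)
          = (deriv b s ^ 2 + f s ^ 2 * b s ^ 2) / s := by ring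
        rw [this]; positivity
  by_contra! hc
  set μ := b r * (deriv b r / r) with hμ
  have hμ0 : 0 < μ := by rw [hμ, ← mul_div_assoc]; positivity
  obtain ⟨C, hC, hbC⟩ := h.exists_abs_b_le
  obtain ⟨s, hs, hs'⟩ := h.exists_abs_deriv_b_lt (ε := μ / C) (by positivity) (max r 1)
  have hs1 : 1 < s := (le_max_right _ _).trans_lt hs
  have hs0 : 0 < s := one_pos.trans hs1
  have h1 : μ ≤ b s * (deriv b s / s) := hm hr hs0 ((le_max_left _ _).trans hs.le)
  have h2 : b s * (deriv b s / s) ≤ |b s| * (|deriv b s| / s) := by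
    rw [← abs_of_pos hs0, ← abs_div, ← abs_mul, abs_of_pos hs0]; exact le_abs_self _
  have h3 : |b s| * (|deriv b s| / s) ≤ C * s * (|deriv b s| / s) := by
    gcongr; exact hbC s hs1.le
  have h4 : C * s * (|deriv b s| / s) = C * |deriv b s| := by field_simp
  rw [lt_div_iff₀ hC] at hs'
  linarith

/-- Since `b ^ 2` is nonincreasing, a zero of `b` makes `b` vanish from there on, hence everywhere
by ODE uniqueness, against `b → 1` at the origin. -/
lemma b_pos (h : IsVortex N lam f b) {r : ℝ} (hr : 0 < r) : 0 < b r := by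
  have hanti : AntitoneOn (fun r => b r ^ 2) (Ioi 0) :=
    antitoneOn_of_hasDerivAt_nonpos (convex_Ioi 0) (fun s hs => (h.db s hs).pow 2)
      fun s hs => by
        have := h.b_mul_deriv_nonpos hs
        norm_num; linarith
  have hne : ∀ s, 0 < s → b s ≠ 0 := by
    intro s hs hs0
    have hz : ∀ t, s ≤ t → b t = 0 := by
      intro t ht
      have h1 : b t ^ 2 ≤ b s ^ 2 := hanti hs (hs.trans_le ht) ht
      rw [hs0] at h1
      nlinarith [sq_nonneg (b t)]
    have h1 : HasDerivAt b 0 (s + 1) := by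
      refine (hasDerivAt_const (s + 1) (0 : ℝ)).congr_of_eventuallyEq ?_
      filter_upwards [Ioi_mem_nhds (show s < s + 1 by linarith)] with t ht using hz t (le_of_lt ht)
    have hall : ∀ t, 0 < t → b t = 0 := fun t ht =>
      eq_zero_of_linear_ode (A := fun r => f r ^ 2) (B := fun r => r⁻¹) h.db
        (fun r hr => (h.ddb r hr).congr_deriv (by ring)) (h.continuousOn_f.pow 2)
        (continuousOn_inv₀.mono fun x hx => (ne_of_gt hx : x ≠ 0))
        (show 0 < s + 1 by linarith) (hz _ (by linarith)) h1.deriv ht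
    obtain ⟨t, ht, ht'⟩ := ((h.tendsto_b_zero.eventually (lt_mem_nhds one_pos)).and
      self_mem_nhdsWithin).exists
    rw [hall t ht'] at ht
    exact lt_irrefl _ ht
  by_contra! hc
  obtain ⟨t, ⟨ht, ht'⟩, ht''⟩ := ((h.tendsto_b_zero.eventually (lt_mem_nhds one_pos)).and
    self_mem_nhdsWithin).and (Ioo_mem_nhdsGT hr) |>.exists
  obtain ⟨s, hs, hs'⟩ := intermediate_value_Icc' ht''.2.le
    (h.continuousOn_b.mono fun z hz => lt_of_lt_of_le ht''.1 hz.1)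
    (show (0 : ℝ) ∈ Icc (b r) (b t) from ⟨hc, ht.le⟩)
  exact hne s (lt_of_lt_of_le ht''.1 hs.1) hs'

lemma monotoneOn_deriv_b_div (h : IsVortex N lam f b) :
    MonotoneOn (fun r => deriv b r / r) (Ioi 0) :=
  monotoneOn_of_hasDerivAt_nonneg (convex_Ioi 0) (fun _ hs => h.hasDerivAt_deriv_b_div hs)
    fun s hs => by
      have hs' : 0 < s := hs
      have := h.b_pos hs
      positivity

/-- A zero of the nondecreasing, nonpositive function `b' / r` would persist to the right, so its
derivative `f ^ 2 b / r` would vanish there, even at a point where `f` is nonzero. -/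
lemma deriv_b_neg (h : IsVortex N lam f b) {r : ℝ} (hr : 0 < r) : deriv b r < 0 := by
  have hle : ∀ s, 0 < s → deriv b s ≤ 0 := fun s hs =>
    nonpos_of_mul_nonpos_right (h.b_mul_deriv_nonpos hs) (h.b_pos hs)
  refine lt_of_le_of_ne (hle r hr) fun h0 => ?_
  have hz : ∀ s, r ≤ s → deriv b s / s = 0 := by
    intro s hs
    have hs0 := hr.trans_le hs
    have h1 : deriv b r / r ≤ deriv b s / s := h.monotoneOn_deriv_b_div hr hs0 hs
    rw [h0, zero_div] at h1
    exact le_antisymm (div_nonpos_of_nonpos_of_nonneg (hle s hs0) hs0.le) h1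
  obtain ⟨s, hs, hs'⟩ := h.exists_abs_one_sub_f_lt one_pos r
  have hs0 := hr.trans hs
  have h1 : HasDerivAt (fun r => deriv b r / r) 0 s := by
    refine (hasDerivAt_const s (0 : ℝ)).congr_of_eventuallyEq ?_
    filter_upwards [Ioi_mem_nhds hs] with t ht using hz t (le_of_lt ht)
  have h2 := h1.unique (h.hasDerivAt_deriv_b_div hs0)
  have hf : f s ≠ 0 := by
    intro hf; rw [hf] at hs'; norm_num at hs'
  have := h.b_pos hs0
  have : 0 < f s ^ 2 * b s / s := by positivity
  linarith

lemma strictAntiOn_b (h : IsVortex N lam f b) : StrictAntiOn b (Ioi 0) :=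
  strictAntiOn_of_deriv_neg (convex_Ioi 0) h.continuousOn_b fun r hr => by
    rw [interior_Ioi] at hr; exact h.deriv_b_neg hr

lemma b_lt_one (h : IsVortex N lam f b) {r : ℝ} (hr : 0 < r) : b r < 1 := by
  have h1 : b (r / 2) ≤ 1 := by
    refine ge_of_tendsto h.tendsto_b_zero ?_
    filter_upwards [Ioo_mem_nhdsGT (show 0 < r / 2 by positivity)] with t ht
    exact (h.strictAntiOn_b ht.1 (show 0 < r / 2 by positivity) ht.2).le
  exact (h.strictAntiOn_b (show 0 < r / 2 by positivity) hr (by linarith)).trans_le h1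

/-- `r |b'| ≤ 2 (1 - b)`. -/
lemma neg_mul_deriv_b_le (h : IsVortex N lam f b) {r : ℝ} (hr : 0 < r) :
    -(r * deriv b r) ≤ 2 * (1 - b r) := by
  -- The derivative is `r f ^ 2 b`, and square integrability of `b' / r` bounds the function below
  -- by any `-ε` at some small radii.
  have hm : MonotoneOn (fun r => 2 * (1 - b r) + r * deriv b r) (Ioi 0) := by
    refine monotoneOn_of_hasDerivAt_nonneg (convex_Ioi 0)
      (g' := fun r => r * (f r ^ 2 * b r)) (fun s hs => ?_) fun s hs => ?_
    · have hs' : 0 < s := hs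
      refine ((((h.db s hs).const_sub 1).const_mul 2).add
        ((hasDerivAt_id s).mul (h.ddb s hs))).congr_deriv ?_
      simp only [id]; field_simp; ring
    · have hs' : 0 < s := hs
      have := h.b_pos hs
      positivity
  have hlim : ∀ ε > 0, -ε ≤ 2 * (1 - b r) + r * deriv b r := by
    intro ε hε
    obtain ⟨s, hs, hsr, hs'⟩ := exists_mul_abs_lt_near_zero one_pos
      (h.int_db.mono_set Ioc_subset_Ioi_self) hε (lt_min hr one_pos)
    rw [abs_div, abs_of_pos hs, mul_div_cancel₀ _ hs.ne'] at hs'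
    have h1 : 2 * (1 - b s) + s * deriv b s ≤ 2 * (1 - b r) + r * deriv b r :=
      hm hs hr (hsr.trans_le (min_le_left _ _)).le
    have h2 := h.b_lt_one hs
    have h3 := neg_abs_le (deriv b s)
    have h4 : s < 1 := hsr.trans_le (min_le_right _ _)
    nlinarith [abs_nonneg (deriv b s)]
  have : 0 ≤ 2 * (1 - b r) + r * deriv b r :=
    le_of_forall_pos_le_add fun ε hε => by linarith [hlim ε hε]
  linarith

lemma tendsto_mul_deriv_b_zero (h : IsVortex N lam f b) :
    Tendsto (fun r => r * deriv b r) (𝓝[>] 0) (𝓝 0) := by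
  have h1 : Tendsto (fun r => -(2 * (1 - b r))) (𝓝[>] 0) (𝓝 0) := by
    simpa using ((h.tendsto_b_zero.const_sub 1).const_mul 2).neg
  refine tendsto_of_tendsto_of_tendsto_of_le_of_le' h1 tendsto_const_nhds ?_ ?_
  · filter_upwards [self_mem_nhdsWithin] with r hr
    linarith [h.neg_mul_deriv_b_le hr]
  · filter_upwards [self_mem_nhdsWithin] with r hr
    exact mul_nonpos_of_nonneg_of_nonpos (le_of_lt hr) (h.deriv_b_neg hr).le

lemma exists_tendsto_b_atTop (h : IsVortex N lam f b) :
    ∃ β, 0 ≤ β ∧ (∀ r, 0 < r → β ≤ b r) ∧ Tendsto b atTop (𝓝 β) := by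
  have hbdd : BddBelow (b '' Ioi 0) := ⟨0, by rintro _ ⟨r, hr, rfl⟩; exact (h.b_pos hr).le⟩
  have hne : (b '' Ioi 0).Nonempty := (nonempty_Ioi).image _
  have hle : ∀ r, 0 < r → sInf (b '' Ioi 0) ≤ b r := fun r hr => csInf_le hbdd ⟨r, hr, rfl⟩
  refine ⟨sInf (b '' Ioi 0), le_csInf hne (by rintro _ ⟨r, hr, rfl⟩; exact (h.b_pos hr).le),
    hle, tendsto_order.2 ⟨fun x hx => ?_, fun x hx => ?_⟩⟩
  · filter_upwards [eventually_gt_atTop 0] with r hr using hx.trans_le (hle r hr)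
  · obtain ⟨_, ⟨s, hs, rfl⟩, hs'⟩ := exists_lt_of_csInf_lt hne hx
    have hs0 : 0 < s := hs
    filter_upwards [eventually_ge_atTop s] with r hr
    exact (h.strictAntiOn_b.antitoneOn hs (hs0.trans_le hr) hr).trans_lt hs'

/-- As `b' / r` is nondecreasing, `r b'(r)` is bounded below by 4 times the increment of `b` over
`[r / 2, r]`, which tends to 0 because `b` converges. -/
lemma tendsto_mul_deriv_b_atTop (h : IsVortex N lam f b) :
    Tendsto (fun r => r * deriv b r) atTop (𝓝 0) := by
  obtain ⟨β, -, -, hβ⟩ := h.exists_tendsto_b_atTop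
  have h2 : Tendsto (fun r : ℝ => r / 2) atTop atTop :=
    tendsto_id.atTop_div_const (by norm_num)
  have h1 : Tendsto (fun r => -(4 * (b (r / 2) - b r))) atTop (𝓝 0) := by
    simpa using (((hβ.comp h2).sub hβ).const_mul 4).neg
  refine tendsto_of_tendsto_of_tendsto_of_le_of_le' h1 tendsto_const_nhds ?_ ?_
  · filter_upwards [eventually_gt_atTop 0] with r hr
    have hr2 : 0 < r / 2 := by positivity
    obtain ⟨ξ, hξ, hξ'⟩ := exists_deriv_eq_slope b (show r / 2 < r by linarith)
      (h.continuousOn_b.mono fun z hz => lt_of_lt_of_le hr2 hz.1)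
      fun z hz => (h.db z (hr2.trans hz.1)).differentiableAt.differentiableWithinAt
    have hξ0 : 0 < ξ := hr2.trans hξ.1
    have h3 : deriv b ξ / ξ ≤ deriv b r / r := h.monotoneOn_deriv_b_div hξ0 hr hξ.2.le
    rw [eq_div_iff (by linarith)] at hξ'
    rw [div_le_div_iff₀ hξ0 hr] at h3
    have h4 := h.deriv_b_neg hr
    nlinarith [hξ.1]
  · filter_upwards [eventually_gt_atTop 0] with r hr
    exact mul_nonpos_of_nonneg_of_nonpos (le_of_lt hr) (h.deriv_b_neg hr).le

end IsVortex

/-! ### The amplitude: bounds, monotonicity and limits of `f`, and decay of `b`. -/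

namespace IsVortex

variable {N lam : ℝ} {f b : ℝ → ℝ}

lemma hasDerivAt_mul_deriv_f (h : IsVortex N lam f b) {r : ℝ} (hr : 0 < r) :
    HasDerivAt (fun r => r * deriv f r)
      (f r * (N * b r ^ 2 / r - lam / 2 * (1 - f r ^ 2) * r)) r := by
  refine ((hasDerivAt_id r).mul (h.ddf r hr)).congr_deriv ?_
  simp only [id]; field_simp; ring

lemma exists_coeff_ge (h : IsVortex N lam f b) (hN : 1 ≤ N) :
    ∃ δ > 0, ∀ r ∈ Ioo 0 δ, 1 / 2 ≤ N * b r ^ 2 - lam / 2 * r ^ 2 := by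
  have h1 : Tendsto (fun r => b r ^ 2 - lam / 2 * r ^ 2) (𝓝[>] 0) (𝓝 1) := by
    have h2 : Tendsto (fun r : ℝ => lam / 2 * r ^ 2) (𝓝[>] 0) (𝓝 0) :=
      ((by fun_prop : Continuous fun r : ℝ => lam / 2 * r ^ 2).tendsto' 0 0 (by simp)).mono_left
        nhdsWithin_le_nhds
    simpa using (h.tendsto_b_zero.pow 2).sub h2
  obtain ⟨δ, hδ, hδ'⟩ := mem_nhdsGT_iff_exists_Ioo_subset.1
    (h1.eventually (lt_mem_nhds (show (1 / 2 : ℝ) < 1 by norm_num)))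
  refine ⟨δ, hδ, fun r hr => ?_⟩
  have : 1 / 2 < b r ^ 2 - lam / 2 * r ^ 2 := hδ' hr
  nlinarith [sq_nonneg (b r)]

/-- Near 0 the function `k = r f f'` satisfies `r k' ≥ (r f') ^ 2 + f ^ 2 / 2`. Thus `r k` is
nondecreasing, and it is arbitrarily small along suitable radii, so `k ≥ 0` and `f ^ 2` is
nondecreasing. Were `f ^ 2 ≥ ε` near 0, then `k ≤ C + (ε / 2) log r` would become negative. -/
lemma tendsto_f_sq_zero (h : IsVortex N lam f b) (hN : 1 ≤ N) (hlam : 0 < lam) :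
    ∀ ε > 0, ∃ δ > 0, ∀ r, 0 < r → r < δ → f r ^ 2 < ε := by
  obtain ⟨δ, hδ, hc⟩ := h.exists_coeff_ge hN
  set k : ℝ → ℝ := fun r => f r * (r * deriv f r) with hk
  set k' : ℝ → ℝ := fun r => deriv f r * (r * deriv f r) +
    f r * (f r * (N * b r ^ 2 / r - lam / 2 * (1 - f r ^ 2) * r)) with hk'
  have hkd : ∀ r ∈ Ioo 0 δ, HasDerivAt k (k' r) r := fun r hr =>
    (h.df r hr.1).mul (h.hasDerivAt_mul_deriv_f hr.1)
  have hkb : ∀ r ∈ Ioo 0 δ, (r * deriv f r) ^ 2 + f r ^ 2 / 2 ≤ r * k' r := by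
    intro r hr
    have hr0 : 0 < r := hr.1
    have e : r * k' r = (r * deriv f r) ^ 2 + f r ^ 2 * (N * b r ^ 2 - lam / 2 * r ^ 2)
        + lam / 2 * (r * f r ^ 2) ^ 2 := by
      simp only [hk']; field_simp; ring
    rw [e]
    have := mul_le_mul_of_nonneg_left (hc r hr) (sq_nonneg (f r))
    have : 0 ≤ lam / 2 * (r * f r ^ 2) ^ 2 := by positivity
    linarith
  have hrk : MonotoneOn (fun r => r * k r) (Ioo 0 δ) := by
    refine monotoneOn_of_hasDerivAt_nonneg (convex_Ioo 0 δ)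
      (fun r hr => (hasDerivAt_id r).mul (hkd r hr)) fun r hr => ?_
    have h1 := hkb r hr
    simp only [id, one_mul, hk]
    nlinarith [sq_nonneg (r * deriv f r + f r / 2), sq_nonneg (r * deriv f r), sq_nonneg (f r)]
  have hk0 : ∀ r ∈ Ioo 0 δ, 0 ≤ k r := by
    intro r hr
    by_contra! hneg
    have hr0 : 0 < r := hr.1
    set κ := -(r * k r) with hκ
    have hκ0 : 0 < κ := by rw [hκ]; nlinarith
    set ε := min 1 (κ / 3) with hε
    have hε0 : 0 < ε := lt_min one_pos (by positivity)
    have hε1 : ε ≤ 1 := min_le_left _ _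
    have hε2 : ε ≤ κ / 3 := min_le_right _ _
    -- The square root combines both integrability conditions, so that a single radius controls `f`
    -- and `f'` simultaneously.
    have hint : IntegrableOn (fun r => Real.sqrt ((1 - f r) ^ 2 + deriv f r ^ 2) ^ 2 * r)
        (Ioc 0 1) := by
      refine ((h.int_f.add h.int_df).mono_set Ioc_subset_Ioi_self).congr_fun
        (fun s _ => ?_) measurableSet_Ioc
      simp only [Pi.add_apply]
      rw [Real.sq_sqrt (by positivity)]; ring
    obtain ⟨s, hs, hsr, hs'⟩ := exists_mul_abs_lt_near_zero one_pos hint hε0 (lt_min hr0 hε0)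
    rw [abs_of_nonneg (Real.sqrt_nonneg _)] at hs'
    have hsr' : s < r := hsr.trans_le (min_le_left _ _)
    have hsε : s < ε := hsr.trans_le (min_le_right _ _)
    have a1 : |1 - f s| ≤ Real.sqrt ((1 - f s) ^ 2 + deriv f s ^ 2) :=
      Real.abs_le_sqrt (by nlinarith [sq_nonneg (deriv f s)])
    have a2 : |deriv f s| ≤ Real.sqrt ((1 - f s) ^ 2 + deriv f s ^ 2) :=
      Real.abs_le_sqrt (by nlinarith [sq_nonneg (1 - f s)])
    have a3 : |f s| ≤ 1 + |1 - f s| := by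
      have := abs_sub_abs_le_abs_sub (f s) 1
      rw [abs_sub_comm, abs_one] at this; linarith
    have a4 : s * |f s| ≤ 2 * ε := by nlinarith
    have a5 : s * |deriv f s| ≤ ε := by nlinarith
    have a6 : s * k s ≤ -κ := by
      rw [hκ, neg_neg]; exact hrk ⟨hs, hsr'.trans hr.2⟩ hr hsr'.le
    have a7 : -(s * k s) ≤ (s * |f s|) * (s * |deriv f s|) := by
      have : (s * |f s|) * (s * |deriv f s|) = |s * k s| := by
        simp only [hk]; rw [abs_mul, abs_mul, abs_mul, abs_of_pos hs]; ring
      rw [this]; exact neg_le_abs _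
    have a8 : (s * |f s|) * (s * |deriv f s|) ≤ 2 * ε * ε := by gcongr
    nlinarith
  have hmono : MonotoneOn (fun r => f r ^ 2) (Ioo 0 δ) :=
    monotoneOn_of_hasDerivAt_nonneg (convex_Ioo 0 δ) (fun r hr => (h.df r hr.1).pow 2)
      fun r hr => by
        have hr0 : 0 < r := hr.1
        have h1 : 0 ≤ r * (f r * deriv f r) := by have := hk0 r hr; simp only [hk] at this; linarith
        have h2 := nonneg_of_mul_nonneg_right h1 hr0
        norm_num; linarith
  intro ε hε
  by_contra! hcon
  have hge : ∀ r ∈ Ioo 0 δ, ε ≤ f r ^ 2 := by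
    intro r hr
    obtain ⟨s, hs, hsr, hs'⟩ := hcon r hr.1
    exact hs'.trans (hmono ⟨hs, hsr.trans hr.2⟩ hr hsr.le)
  have hlog : MonotoneOn (fun r => k r - ε / 2 * Real.log r) (Ioo 0 δ) := by
    refine monotoneOn_of_hasDerivAt_nonneg (convex_Ioo 0 δ)
      (fun r hr => (hkd r hr).sub ((Real.hasDerivAt_log hr.1.ne').const_mul _)) fun r hr => ?_
    have hr0 : 0 < r := hr.1
    have h1 := hkb r hr
    have h2 := hge r hr
    have e : k' r - ε / 2 * r⁻¹ = (r * k' r - ε / 2) / r := by field_simp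
    rw [e]
    refine div_nonneg ?_ hr0.le
    nlinarith [sq_nonneg (r * deriv f r)]
  have hd2 : δ / 2 ∈ Ioo 0 δ := ⟨by positivity, by linarith⟩
  set C := k (δ / 2) - ε / 2 * Real.log (δ / 2)
  obtain ⟨r, hr, hr'⟩ := ((Real.tendsto_log_nhdsGT_zero.eventually
    (eventually_lt_atBot (-(2 * C / ε)))).and (Ioo_mem_nhdsGT hd2.1)).exists
  have hrm : r ∈ Ioo 0 δ := ⟨hr'.1, hr'.2.trans hd2.2⟩
  have h1 : k r - ε / 2 * Real.log r ≤ C := hlog hrm hd2 hr'.2.le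
  have h2 := hk0 r hrm
  have h3 : ε / 2 * Real.log r < ε / 2 * -(2 * C / ε) := by gcongr
  have h4 : ε / 2 * -(2 * C / ε) = -C := by field_simp
  linarith

/-- At a critical point with `f ^ 2 ≥ 1` the equation gives `(f ^ 2)'' > 0`, hence a local minimum.
Being also a maximum, `f ^ 2` would be locally constant, with zero second derivative. -/
lemma not_isLocalMax_f_sq (h : IsVortex N lam f b) (hN : 1 ≤ N) (hlam : 0 < lam) {r : ℝ}
    (hr : 0 < r) (h1 : 1 ≤ f r ^ 2) : ¬ IsLocalMax (fun r => f r ^ 2) r := by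
  intro hmax
  have hd : ∀ s, 0 < s → HasDerivAt (fun r => f r ^ 2) (2 * f s * deriv f s) s := fun s hs =>
    ((h.df s hs).pow 2).congr_deriv (by simp)
  have h0 : 2 * f r * deriv f r = 0 := hmax.hasDerivAt_eq_zero (hd r hr)
  have hf0 : f r ≠ 0 := by intro hf; rw [hf] at h1; norm_num at h1
  have hdf : deriv f r = 0 := by simpa [hf0] using h0
  have hev : deriv (fun r => f r ^ 2) =ᶠ[𝓝 r] fun s => 2 * f s * deriv f s := by
    filter_upwards [Ioi_mem_nhds hr] with s hs using (hd s hs).deriv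
  have hdd : deriv (deriv fun r => f r ^ 2) r =
      2 * f r ^ 2 * (N * b r ^ 2 / r ^ 2 - lam / 2 * (1 - f r ^ 2)) := by
    have hprod : HasDerivAt (fun s => 2 * f s * deriv f s) _ r :=
      ((h.df r hr).const_mul 2).mul (h.ddf r hr)
    rw [hev.deriv_eq, hprod.deriv, hdf]; ring
  have hpos : 0 < deriv (deriv fun r => f r ^ 2) r := by
    rw [hdd]
    have hb := h.b_pos hr
    have : 0 < N * b r ^ 2 / r ^ 2 := by positivity
    have : 0 ≤ lam / 2 * (f r ^ 2 - 1) := mul_nonneg (by positivity) (by linarith)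
    have : 0 < N * b r ^ 2 / r ^ 2 - lam / 2 * (1 - f r ^ 2) := by linarith
    positivity
  have hmin := isLocalMin_of_deriv_deriv_pos hpos ((hd r hr).deriv.trans h0)
    (hd r hr).continuousAt
  have hconst : (fun s => f s ^ 2) =ᶠ[𝓝 r] fun _ => f r ^ 2 := by
    filter_upwards [hmin, hmax] with s h2 h3 using le_antisymm h3 h2
  have := hconst.deriv.deriv_eq
  simp at this
  linarith

lemma f_sq_lt_one (h : IsVortex N lam f b) (hN : 1 ≤ N) (hlam : 0 < lam) {r : ℝ} (hr : 0 < r) :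
    f r ^ 2 < 1 := by
  have hle : ∀ r, 0 < r → f r ^ 2 ≤ 1 := by
    intro r hr
    by_contra! hgt
    obtain ⟨δ, hδ, hδ'⟩ := h.tendsto_f_sq_zero hN hlam 1 one_pos
    set α := min δ r / 2
    have hm : 0 < min δ r := lt_min hδ hr
    have hα : 0 < α := by positivity
    have hαδ : α < δ := by have := min_le_left δ r; simp only [α]; linarith
    have hαr : α < r := by have := min_le_right δ r; simp only [α]; linarith
    set ε := min 1 ((f r ^ 2 - 1) / 4)
    have hε : 0 < ε := lt_min one_pos (by linarith)
    have hε1 : ε ≤ 1 := min_le_left _ _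
    have hε2 : ε ≤ (f r ^ 2 - 1) / 4 := min_le_right _ _
    obtain ⟨β, hβ, hβ'⟩ := h.exists_abs_one_sub_f_lt hε r
    rw [abs_lt] at hβ'
    have hβf : f β ^ 2 < f r ^ 2 := by nlinarith
    have hαf : f α ^ 2 < f r ^ 2 := (hδ' α hα hαδ).trans hgt
    obtain ⟨c, hc, hcm⟩ := isCompact_Icc.exists_isMaxOn (nonempty_Icc.2 (hαr.trans hβ).le)
      ((h.continuousOn_f.pow 2).mono fun z (hz : z ∈ Icc α β) => lt_of_lt_of_le hα hz.1)
    have hcr : f r ^ 2 ≤ f c ^ 2 := hcm ⟨hαr.le, hβ.le⟩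
    have hc1 : c ≠ α := by rintro rfl; linarith
    have hc2 : c ≠ β := by rintro rfl; linarith
    exact h.not_isLocalMax_f_sq hN hlam (hα.trans_le hc.1) (by linarith)
      (hcm.isLocalMax (Icc_mem_nhds (lt_of_le_of_ne hc.1 hc1.symm) (lt_of_le_of_ne hc.2 hc2)))
  refine lt_of_le_of_ne (hle r hr) fun h1 => h.not_isLocalMax_f_sq hN hlam hr h1.ge ?_
  filter_upwards [Ioi_mem_nhds hr] with s hs
  rw [h1]; exact hle s hs

/-- After an interior maximum of `f²` over an initial interval, `f²` never returns to its value. -/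
lemma not_return (h : IsVortex N lam f b) (hN : 1 ≤ N) {x y : ℝ} (hx : 0 < x) (hxy : x < y)
    (hx0 : f x ≠ 0) (hd : deriv f x = 0) (hle : ∀ r ∈ Icc x y, f r ^ 2 ≤ f x ^ 2)
    (hy : f y ^ 2 = f x ^ 2) : False := by
  set m := f x ^ 2
  -- A mechanical energy with time-dependent potential `V = N b ^ 2 / r ^ 2`, normalized so that the
  -- `V` term vanishes at both ends. Friction and the decrease of `V` make `e` nonincreasing while
  -- `f ^ 2 ≤ m`, yet `e y - e x = f'(y) ^ 2 / 2 ≥ 0`; so `e` is constant.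
  set e : ℝ → ℝ := fun r => deriv f r ^ 2 / 2 - lam / 8 * (f r ^ 2 - 1) ^ 2
    - N * b r ^ 2 / r ^ 2 * (f r ^ 2 - m) / 2 with he
  set e' : ℝ → ℝ := fun r => -(deriv f r ^ 2 / r)
    - (m - f r ^ 2) * (N * b r * (b r - r * deriv b r) / r ^ 3) with he'
  have hpos : ∀ r ∈ Icc x y, 0 < r := fun r hr => hx.trans_le hr.1
  have hed : ∀ r ∈ Icc x y, HasDerivAt e (e' r) r := by
    intro r hr
    have hr0 := hpos r hr
    refine (((((h.ddf r hr0).pow 2).div_const 2).sub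
      (((((h.df r hr0).pow 2).sub_const 1).pow 2).const_mul (lam / 8))).sub
      ((((((h.db r hr0).pow 2).const_mul N).div ((hasDerivAt_id r).pow 2)
        (by simp [hr0.ne'])).mul (((h.df r hr0).pow 2).sub_const m)).div_const 2)).congr_deriv ?_
    simp [he']
    field_simp; ring
  have hc : ∀ r ∈ Icc x y, 0 < N * b r * (b r - r * deriv b r) / r ^ 3 := by
    intro r hr
    have hr0 := hpos r hr
    have h1 := h.b_pos hr0
    have h2 := mul_neg_of_pos_of_neg hr0 (h.deriv_b_neg hr0)
    have h3 : 0 < b r - r * deriv b r := by linarith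
    positivity
  have hanti : AntitoneOn e (Icc x y) := by
    refine antitoneOn_of_hasDerivAt_nonpos (convex_Icc x y) hed fun r hr => ?_
    have hr0 := hpos r hr
    have h1 := mul_nonneg (sub_nonneg.2 (hle r hr)) (hc r hr).le
    have h2 : 0 ≤ deriv f r ^ 2 / r := by positivity
    simp only [he']; linarith
  have hends : e x ≤ e y := by
    have e1 : e x = -(lam / 8 * (m - 1) ^ 2) := by
      simp only [he, hd]; ring_nf; simp only [m]; ring
    have e2 : e y = deriv f y ^ 2 / 2 - lam / 8 * (m - 1) ^ 2 := by
      simp only [he, hy]; ring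
    rw [e1, e2]; nlinarith [sq_nonneg (deriv f y)]
  have hconst : ∀ r ∈ Icc x y, e r = e x := fun r hr =>
    le_antisymm (hanti (left_mem_Icc.2 hxy.le) hr hr.1)
      (hends.trans (hanti hr (right_mem_Icc.2 hxy.le) hr.2))
  have hz : ∀ r ∈ Ioo x y, deriv f r = 0 ∧ f r ^ 2 = m := by
    intro r hr
    have hr' := Ioo_subset_Icc_self hr
    have hr0 := hpos r hr'
    have h0 : HasDerivAt e 0 r := by
      refine (hasDerivAt_const r (e x)).congr_of_eventuallyEq ?_
      filter_upwards [Icc_mem_nhds hr.1 hr.2] with s hs using hconst s hs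
    have h1 := h0.unique (hed r hr')
    have h2 := mul_nonneg (sub_nonneg.2 (hle r hr')) (hc r hr').le
    have h3 : 0 ≤ deriv f r ^ 2 / r := by positivity
    simp only [he'] at h1
    have h4 : deriv f r ^ 2 / r = 0 := by linarith
    have h5 : (m - f r ^ 2) * (N * b r * (b r - r * deriv b r) / r ^ 3) = 0 := by linarith
    constructor
    · simpa [hr0.ne'] using h4
    · have := (mul_eq_zero.1 h5).resolve_right (hc r hr').ne'
      linarith
  -- With `f'` zero and `f ^ 2` constant the equation forces `V` to be constant, contrary to its
  -- strict decrease.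
  have hV : ∀ r ∈ Ioo x y, N * b r ^ 2 / r ^ 2 = lam / 2 * (1 - m) := by
    intro r hr
    have hr0 := hpos r (Ioo_subset_Icc_self hr)
    have h0 : HasDerivAt (deriv f) 0 r := by
      refine (hasDerivAt_const r (0 : ℝ)).congr_of_eventuallyEq ?_
      filter_upwards [Ioo_mem_nhds hr.1 hr.2] with s hs using (hz s hs).1
    have h1 := h0.unique (h.ddf r hr0)
    rw [(hz r hr).1, (hz r hr).2, zero_div, sub_zero] at h1
    have hf : f r ≠ 0 := by
      intro hf
      have := (hz r hr).2
      rw [hf] at this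
      exact hx0 (by simpa [m] using this.symm)
    have := (mul_eq_zero.1 h1.symm).resolve_left hf
    linarith
  have u1 : (2 * x + y) / 3 ∈ Ioo x y := ⟨by linarith, by linarith⟩
  have u2 : (x + 2 * y) / 3 ∈ Ioo x y := ⟨by linarith, by linarith⟩
  have p1 := hpos _ (Ioo_subset_Icc_self u1)
  have p2 := hpos _ (Ioo_subset_Icc_self u2)
  have hlt : (2 * x + y) / 3 < (x + 2 * y) / 3 := by linarith
  have hb := h.strictAntiOn_b p1 p2 hlt
  have hb0 := h.b_pos p2
  have : N * b ((x + 2 * y) / 3) ^ 2 / ((x + 2 * y) / 3) ^ 2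
      < N * b ((2 * x + y) / 3) ^ 2 / ((2 * x + y) / 3) ^ 2 := by gcongr
  rw [hV _ u1, hV _ u2] at this
  exact lt_irrefl _ this

lemma exists_f_ne_zero (h : IsVortex N lam f b) {t : ℝ} (ht : 0 < t) :
    ∃ s, 0 < s ∧ s < t ∧ f s ≠ 0 := by
  by_contra! hz
  have ht2 : 0 < t / 2 := by positivity
  have hd : HasDerivAt f 0 (t / 2) := by
    refine (hasDerivAt_const (t / 2) (0 : ℝ)).congr_of_eventuallyEq ?_
    filter_upwards [Ioo_mem_nhds ht2 (show t / 2 < t by linarith)] with s hs using hz s hs.1 hs.2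
  obtain ⟨r, hr, hr'⟩ := h.exists_abs_one_sub_f_lt one_pos 0
  have hcont : ContinuousOn (fun r => N * b r ^ 2 / r ^ 2 - lam / 2 * (1 - f r ^ 2)) (Ioi 0) := by
    refine ContinuousOn.sub (ContinuousOn.div (continuousOn_const.mul (h.continuousOn_b.pow 2))
      (continuousOn_id.pow 2) fun s hs => ?_) ?_
    · exact pow_ne_zero 2 (ne_of_gt hs)
    · exact continuousOn_const.mul (continuousOn_const.sub (h.continuousOn_f.pow 2))
  have hinv : ContinuousOn (fun r : ℝ => r⁻¹) (Ioi 0) :=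
    continuousOn_inv₀.mono fun x hx => (ne_of_gt hx : x ≠ 0)
  have := eq_zero_of_linear_ode (B := fun r => -r⁻¹) h.df
    (fun r hr => (h.ddf r hr).congr_deriv (by ring)) hcont
    hinv.neg ht2
    (hz _ ht2 (by linarith)) hd.deriv hr
  rw [this] at hr'
  norm_num at hr'

/-- If strict increase fails, `f ^ 2` attains its maximum over `(0, t]` at some `x < t`. Since `f ^
2 < 1` takes values arbitrarily close to 1 further out, it must come back to the level `f x ^ 2`;
`not_return` excludes this. -/
lemma strictMonoOn_f_sq (h : IsVortex N lam f b) (hN : 1 ≤ N) (hlam : 0 < lam) :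
    StrictMonoOn (fun r => f r ^ 2) (Ioi 0) := by
  intro s₀ hs₀ t ht hst₀
  by_contra! hle₀
  have ht0 : 0 < t := ht
  obtain ⟨s, hs, hst, hfs, hle⟩ : ∃ s, 0 < s ∧ s < t ∧ f s ≠ 0 ∧ f t ^ 2 ≤ f s ^ 2 := by
    by_cases hf : f s₀ = 0
    · obtain ⟨s, hs, hst, hfs⟩ := h.exists_f_ne_zero ht0
      refine ⟨s, hs, hst, hfs, ?_⟩
      simp only [hf] at hle₀
      nlinarith [sq_nonneg (f s)]
    · exact ⟨s₀, hs₀, hst₀, hf, hle₀⟩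
  have hfs2 : 0 < f s ^ 2 := by positivity
  obtain ⟨δ, hδ, hδ'⟩ := h.tendsto_f_sq_zero hN hlam _ hfs2
  set α := min δ s / 2
  have hm : 0 < min δ s := lt_min hδ hs
  have hα : 0 < α := by positivity
  have hαδ : α < δ := by have := min_le_left δ s; simp only [α]; linarith
  have hαs : α < s := by have := min_le_right δ s; simp only [α]; linarith
  have hcont : ContinuousOn (fun r => f r ^ 2) (Ioi 0) := h.continuousOn_f.pow 2
  obtain ⟨x, hx, hxt, hsx, hmax⟩ : ∃ x, 0 < x ∧ x < t ∧ f s ^ 2 ≤ f x ^ 2 ∧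
      ∀ r, 0 < r → r ≤ t → f r ^ 2 ≤ f x ^ 2 := by
    obtain ⟨c, hc, hcm⟩ := isCompact_Icc.exists_isMaxOn (nonempty_Icc.2 (hαs.trans hst).le)
      (hcont.mono fun z (hz : z ∈ Icc α t) => lt_of_lt_of_le hα hz.1)
    have hcs : f s ^ 2 ≤ f c ^ 2 := hcm ⟨hαs.le, hst.le⟩
    have hall : ∀ r, 0 < r → r ≤ t → f r ^ 2 ≤ f c ^ 2 := by
      intro r hr hrt
      rcases le_or_gt α r with h1 | h1
      · exact hcm ⟨h1, hrt⟩
      · exact ((hδ' r hr (h1.trans hαδ)).le).trans hcs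
    rcases hc.2.lt_or_eq with h1 | h1
    · exact ⟨c, hα.trans_le hc.1, h1, hcs, hall⟩
    -- If the maximum sits at the right end, `f t ^ 2 ≤ f s ^ 2` makes the interior point `s` a
    -- maximizer as well.
    · subst h1
      exact ⟨s, hs, hst, le_rfl, fun r hr hrt => (hall r hr hrt).trans hle⟩
  have hx1 := h.f_sq_lt_one hN hlam hx
  have hxne : f x ≠ 0 := by
    intro h0; rw [h0] at hsx; norm_num at hsx; exact hfs hsx
  have hdx : deriv f x = 0 := by
    have hloc : IsLocalMax (fun r => f r ^ 2) x := by
      filter_upwards [Ioo_mem_nhds hx hxt] with r hr using hmax r hr.1 hr.2.le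
    have := hloc.hasDerivAt_eq_zero ((h.df x hx).pow 2)
    simpa [hxne] using this
  obtain ⟨β, hβ, hβ'⟩ := h.exists_abs_one_sub_f_lt (ε := (1 - f x ^ 2) / 2) (by linarith) t
  rw [abs_lt] at hβ'
  have hβf : f x ^ 2 < f β ^ 2 := by nlinarith [sq_nonneg (f x)]
  have hcont' : ContinuousOn (fun r => f r ^ 2) (Icc t β) :=
    hcont.mono fun z hz => lt_of_lt_of_le ht0 hz.1
  -- The infimum of `S` is the first return to the level of the maximum.
  set S := Icc t β ∩ (fun r => f r ^ 2) ⁻¹' Ici (f x ^ 2) with hS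
  have hSc : IsCompact S :=
    isCompact_Icc.of_isClosed_subset (hcont'.preimage_isClosed_of_isClosed isClosed_Icc isClosed_Ici)
      inter_subset_left
  have hSn : S.Nonempty := ⟨β, right_mem_Icc.2 hβ.le, hβf.le⟩
  set y := sInf S
  have hy : y ∈ S := hSc.sInf_mem hSn
  have hy1 : f x ^ 2 ≤ f y ^ 2 := hy.2
  have hlt : ∀ r, t ≤ r → r < y → f r ^ 2 < f x ^ 2 := by
    intro r hr hry
    by_contra! hcon
    exact absurd (csInf_le hSc.bddBelow (show r ∈ S from ⟨⟨hr, hry.le.trans hy.1.2⟩, hcon⟩))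
      (not_le.2 hry)
  have hyeq : f y ^ 2 = f x ^ 2 := by
    obtain ⟨c, hc, hc'⟩ := intermediate_value_Icc hy.1.1
      (hcont'.mono (Icc_subset_Icc_right hy.1.2))
      (show f x ^ 2 ∈ Icc (f t ^ 2) (f y ^ 2) from ⟨hmax t ht0 le_rfl, hy1⟩)
    have hcy : c = y := by
      by_contra hne
      exact absurd hc' (hlt c hc.1 (lt_of_le_of_ne hc.2 hne)).ne
    rw [← hcy]; exact hc'
  refine h.not_return hN hx (hxt.trans_le hy.1.1) hxne hdx (fun r hr => ?_) hyeq
  rcases le_or_gt r t with h1 | h1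
  · exact hmax r (hx.trans_le hr.1) h1
  · rcases hr.2.lt_or_eq with h2 | h2
    · exact (hlt r h1.le h2).le
    · rw [h2, hyeq]

lemma f_pos (h : IsVortex N lam f b) (hN : 1 ≤ N) (hlam : 0 < lam) {r : ℝ} (hr : 0 < r) :
    0 < f r := by
  have hne : ∀ r, 0 < r → f r ≠ 0 := by
    intro r hr h0
    have := h.strictMonoOn_f_sq hN hlam (show r / 2 ∈ Ioi 0 by simpa using hr) hr (by linarith)
    simp only [h0] at this
    nlinarith [sq_nonneg (f (r / 2))]
  by_contra! hc
  obtain ⟨β, hβ, hβ'⟩ := h.exists_abs_one_sub_f_lt one_pos r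
  rw [abs_lt] at hβ'
  obtain ⟨s, hs, hs'⟩ := intermediate_value_Icc hβ.le
    (h.continuousOn_f.mono fun z hz => lt_of_lt_of_le hr hz.1)
    (show (0 : ℝ) ∈ Icc (f r) (f β) from ⟨hc, by linarith⟩)
  exact hne s (hr.trans_le hs.1) hs'

lemma f_lt_one (h : IsVortex N lam f b) (hN : 1 ≤ N) (hlam : 0 < lam) {r : ℝ} (hr : 0 < r) :
    f r < 1 := by
  have := h.f_sq_lt_one hN hlam hr
  nlinarith [h.f_pos hN hlam hr]

lemma strictMonoOn_f (h : IsVortex N lam f b) (hN : 1 ≤ N) (hlam : 0 < lam) :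
    StrictMonoOn f (Ioi 0) := fun _ hs _ ht hst =>
  lt_of_pow_lt_pow_left₀ 2 (h.f_pos hN hlam ht).le (h.strictMonoOn_f_sq hN hlam hs ht hst)

lemma deriv_f_nonneg (h : IsVortex N lam f b) (hN : 1 ≤ N) (hlam : 0 < lam) {r : ℝ} (hr : 0 < r) :
    0 ≤ deriv f r := by
  have := (h.strictMonoOn_f hN hlam).monotoneOn.derivWithin_nonneg (x := r)
  rwa [derivWithin_of_isOpen isOpen_Ioi hr] at this

lemma tendsto_f_zero (h : IsVortex N lam f b) (hN : 1 ≤ N) (hlam : 0 < lam) :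
    Tendsto f (𝓝[>] 0) (𝓝 0) := by
  rw [Metric.tendsto_nhdsWithin_nhds]
  intro ε hε
  obtain ⟨δ, hδ, h1⟩ := h.tendsto_f_sq_zero hN hlam (ε ^ 2) (by positivity)
  refine ⟨δ, hδ, fun r hr hrd => ?_⟩
  have hr0 : 0 < r := hr
  rw [dist_zero_right, Real.norm_of_nonneg hr0.le] at hrd
  rw [dist_zero_right, Real.norm_eq_abs]
  exact abs_lt_of_sq_lt_sq (h1 r hr0 hrd) hε.le

lemma tendsto_f_atTop (h : IsVortex N lam f b) (hN : 1 ≤ N) (hlam : 0 < lam) :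
    Tendsto f atTop (𝓝 1) := by
  refine tendsto_order.2 ⟨fun x hx => ?_, fun x hx => ?_⟩
  · obtain ⟨s, hs, hs'⟩ := h.exists_abs_one_sub_f_lt (sub_pos.2 hx) 0
    rw [abs_lt] at hs'
    filter_upwards [eventually_ge_atTop s] with r hr
    have : f s ≤ f r := (h.strictMonoOn_f hN hlam).monotoneOn hs (hs.trans_le hr) hr
    linarith
  · filter_upwards [eventually_gt_atTop 0] with r hr using (h.f_lt_one hN hlam hr).trans hx

lemma tendsto_mul_deriv_f_zero (h : IsVortex N lam f b) (hN : 1 ≤ N) (hlam : 0 < lam) :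
    Tendsto (fun r => r * deriv f r) (𝓝[>] 0) (𝓝 0) := by
  obtain ⟨δ, hδ, hc⟩ := h.exists_coeff_ge hN
  have hmono : MonotoneOn (fun r => r * deriv f r) (Ioo 0 δ) := by
    refine monotoneOn_of_hasDerivAt_nonneg (convex_Ioo 0 δ)
      (fun r hr => h.hasDerivAt_mul_deriv_f hr.1) fun r hr => ?_
    have hr0 : 0 < r := hr.1
    have h1 := hc r hr
    have h2 := h.f_pos hN hlam hr0
    have e : N * b r ^ 2 / r - lam / 2 * (1 - f r ^ 2) * r
        = (N * b r ^ 2 - lam / 2 * r ^ 2 + lam / 2 * f r ^ 2 * r ^ 2) / r := by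
      field_simp; ring
    rw [e]
    have : 0 ≤ N * b r ^ 2 - lam / 2 * r ^ 2 + lam / 2 * f r ^ 2 * r ^ 2 := by
      have : 0 ≤ lam / 2 * f r ^ 2 * r ^ 2 := by positivity
      linarith
    positivity
  refine tendsto_order.2 ⟨fun x hx => ?_, fun x hx => ?_⟩
  · filter_upwards [self_mem_nhdsWithin] with r hr
    exact hx.trans_le (mul_nonneg (le_of_lt hr) (h.deriv_f_nonneg hN hlam hr))
  · obtain ⟨s, hs, hsδ, hs'⟩ := exists_mul_abs_lt_near_zero one_pos
      (h.int_df.mono_set Ioc_subset_Ioi_self) hx hδ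
    filter_upwards [Ioo_mem_nhdsGT hs] with r hr
    have h1 : r * deriv f r ≤ s * deriv f s := hmono ⟨hr.1, hr.2.trans hsδ⟩ ⟨hs, hsδ⟩ hr.2.le
    have h2 := mul_le_mul_of_nonneg_left (le_abs_self (deriv f s)) hs.le
    linarith

/-- By monotonicity of `f`, the integral of `(1 - f) ^ 2 s` over `[r / 2, r]` is at least `(r (1 - f
r)) ^ 2 / 4`, and it tends to 0 by convergence of the full integral. -/
lemma tendsto_mul_one_sub_f (h : IsVortex N lam f b) (hN : 1 ≤ N) (hlam : 0 < lam) :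
    Tendsto (fun r => r * (1 - f r)) atTop (𝓝 0) := by
  set Q : ℝ → ℝ := fun x => ∫ s in (0 : ℝ)..x, (1 - f s) ^ 2 * s with hQ
  have hQt : Tendsto Q atTop (𝓝 (∫ s in Ioi 0, (1 - f s) ^ 2 * s)) :=
    intervalIntegral_tendsto_integral_Ioi 0 h.int_f tendsto_id
  have h2 : Tendsto (fun r : ℝ => r / 2) atTop atTop :=
    tendsto_id.atTop_div_const (by norm_num)
  have hd : Tendsto (fun r => √(4 * (Q r - Q (r / 2)))) atTop (𝓝 0) := by
    have := ((hQt.sub (hQt.comp h2)).const_mul 4).sqrt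
    simpa using this
  refine squeeze_zero' ?_ ?_ hd
  · filter_upwards [eventually_gt_atTop 0] with r hr
    exact mul_nonneg hr.le (by linarith [h.f_lt_one hN hlam hr])
  · filter_upwards [eventually_gt_atTop 0] with r hr
    refine Real.le_sqrt_of_sq_le ?_
    have hr2 : 0 < r / 2 := by positivity
    have hii : ∀ x y, 0 ≤ x → x ≤ y →
        IntervalIntegrable (fun s => (1 - f s) ^ 2 * s) volume x y := fun x y hx hxy =>
      (intervalIntegrable_iff_integrableOn_Ioc_of_le hxy).2
        (h.int_f.mono_set (Ioc_subset_Ioi_self.trans (Ioi_subset_Ioi hx)))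
    have e1 : Q r - Q (r / 2) = ∫ s in (r / 2)..r, (1 - f s) ^ 2 * s :=
      intervalIntegral.integral_interval_sub_left (hii 0 r le_rfl hr.le)
        (hii 0 (r / 2) le_rfl hr2.le)
    have e2 : ∫ _ in (r / 2)..r, (1 - f r) ^ 2 * (r / 2) ≤ Q r - Q (r / 2) := by
      rw [e1]
      refine intervalIntegral.integral_mono_on (by linarith) intervalIntegrable_const
        (hii _ _ hr2.le (by linarith)) fun s hs => ?_
      have hs0 : 0 < s := hr2.trans_le hs.1
      have : f s ≤ f r := (h.strictMonoOn_f hN hlam).monotoneOn hs0 hr hs.2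
      have := h.f_lt_one hN hlam hr
      gcongr
      exact hs.1
    rw [intervalIntegral.integral_const, smul_eq_mul] at e2
    nlinarith

/-- With `u = 1 - f r`, some `ξ` in `(r, r + 1)` has `f'(ξ) ≤ u`. On `[r, ξ]` the equation bounds
`(s f')'` below by `-lam u (r + 1)`, so `r f'(r) ≤ (1 + lam) (r + 1) u`, which is controlled by
`tendsto_mul_one_sub_f`. -/
lemma tendsto_mul_deriv_f_atTop (h : IsVortex N lam f b) (hN : 1 ≤ N) (hlam : 0 < lam) :
    Tendsto (fun r => r * deriv f r) atTop (𝓝 0) := by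
  have h1 : Tendsto (fun r => (1 + lam) * 2 * (r * (1 - f r))) atTop (𝓝 0) := by
    simpa using (h.tendsto_mul_one_sub_f hN hlam).const_mul ((1 + lam) * 2)
  refine squeeze_zero' ?_ ?_ h1
  · filter_upwards [eventually_gt_atTop 0] with r hr
    exact mul_nonneg hr.le (h.deriv_f_nonneg hN hlam hr)
  · filter_upwards [eventually_ge_atTop 1] with r hr
    have hr0 : 0 < r := by linarith
    have hmono := (h.strictMonoOn_f hN hlam).monotoneOn
    obtain ⟨ξ, hξ, hξ'⟩ := exists_deriv_eq_slope f (show r < r + 1 by linarith)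
      (h.continuousOn_f.mono fun z hz => lt_of_lt_of_le hr0 hz.1)
      fun z hz => (h.df z (hr0.trans hz.1)).differentiableAt.differentiableWithinAt
    have hξ0 : 0 < ξ := hr0.trans hξ.1
    obtain ⟨ζ, hζ, hζ'⟩ := exists_hasDerivAt_eq_slope (fun s => s * deriv f s) _ hξ.1
      (fun z hz => (h.hasDerivAt_mul_deriv_f (hr0.trans_le hz.1)).continuousAt.continuousWithinAt)
      fun z hz => h.hasDerivAt_mul_deriv_f (hr0.trans hz.1)
    have hζ0 : 0 < ζ := hr0.trans hζ.1
    set u := 1 - f r with hu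
    have hu0 : 0 < u := by have := h.f_lt_one hN hlam hr0; linarith
    have a1 : deriv f ξ ≤ u := by
      rw [hξ']; have := h.f_lt_one hN hlam (show 0 < r + 1 by linarith)
      rw [show r + 1 - r = 1 by ring, div_one]; linarith
    have a2 : ξ * deriv f ξ ≤ (r + 1) * u := by
      have := h.deriv_f_nonneg hN hlam hξ0
      have := hξ.2
      gcongr
    have b0 := h.f_pos hN hlam hζ0
    have b1 := h.f_lt_one hN hlam hζ0
    have b2 : f r ≤ f ζ := hmono hr0 hζ0 hζ.1.le
    have b3 : ζ ≤ r + 1 := (hζ.2.trans hξ.2).le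
    have b4 : 0 ≤ N * b ζ ^ 2 / ζ := by positivity
    have b5 : (1 - f ζ ^ 2) ≤ 2 * u := by nlinarith
    have b6 : lam / 2 * (1 - f ζ ^ 2) * ζ ≤ lam * u * (r + 1) := by
      have : 0 ≤ 1 - f ζ ^ 2 := by nlinarith
      calc _ ≤ lam / 2 * (2 * u) * (r + 1) := by gcongr
        _ = _ := by ring
    have b7 : 0 ≤ lam * u * (r + 1) := by positivity
    have b8 : -(lam * u * (r + 1)) ≤
        f ζ * (N * b ζ ^ 2 / ζ - lam / 2 * (1 - f ζ ^ 2) * ζ) := by nlinarith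
    rw [hζ', le_div_iff₀ (by linarith [hξ.1])] at b8
    have b9 : ξ - r ≤ 1 := by linarith [hξ.2]
    have c1 : lam * u * (r + 1) * (ξ - r) ≤ lam * u * (r + 1) * 1 := by gcongr
    have c2 : (r + 1) * u ≤ 2 * r * u := by gcongr; linarith
    have c3 : lam * u * (r + 1) ≤ lam * u * (2 * r) := by gcongr; linarith
    linarith

/-- A limit `β > 0` would give `(b' / r)' ≥ β / (4 r)` where `f > 1 / 2`, so `b' / r` would grow
logarithmically, against `b' < 0`. -/
lemma tendsto_b_atTop (h : IsVortex N lam f b) (hN : 1 ≤ N) (hlam : 0 < lam) :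
    Tendsto b atTop (𝓝 0) := by
  obtain ⟨β, hβ, hle, hlim⟩ := h.exists_tendsto_b_atTop
  rcases hβ.eq_or_lt with h0 | h0
  · rwa [← h0] at hlim
  exfalso
  obtain ⟨R, hR⟩ := eventually_atTop.1 (((h.tendsto_f_atTop hN hlam).eventually
    (lt_mem_nhds (show (1 / 2 : ℝ) < 1 by norm_num))).and (eventually_gt_atTop 0))
  have hR0 : 0 < R := (hR R le_rfl).2
  have hmono : MonotoneOn (fun r => deriv b r / r - β / 4 * Real.log r) (Ici R) := by
    refine monotoneOn_of_hasDerivAt_nonneg (convex_Ici R) (fun r hr =>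
      (h.hasDerivAt_deriv_b_div (hR r hr).2).sub
        ((Real.hasDerivAt_log (hR r hr).2.ne').const_mul _)) fun r hr => ?_
    obtain ⟨h1, hr0⟩ := hR r hr
    have h2 := hle r hr0
    have e : f r ^ 2 * b r / r - β / 4 * r⁻¹ = (f r ^ 2 * b r - β / 4) / r := by field_simp
    rw [e]
    have : 1 / 4 ≤ f r ^ 2 := by nlinarith
    refine div_nonneg ?_ hr0.le
    nlinarith
  set C := deriv b R / R - β / 4 * Real.log R
  obtain ⟨r, hr, hr'⟩ := ((Real.tendsto_log_atTop.eventually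
    (eventually_gt_atTop (-(4 * C / β)))).and (eventually_ge_atTop R)).exists
  have h1 : C ≤ deriv b r / r - β / 4 * Real.log r := hmono (mem_Ici.2 le_rfl) hr' hr'
  have h2 : deriv b r / r < 0 := div_neg_of_neg_of_pos (h.deriv_b_neg (hR r hr').2) (hR r hr').2
  have h3 : β / 4 * -(4 * C / β) < β / 4 * Real.log r := by gcongr
  have h4 : β / 4 * -(4 * C / β) = -C := by field_simp
  linarith

end IsVortex

/-! ### Slope functions of the scaling foliation. -/

/-- The slope functions `p`, `q` of the foliation by the rescalings `f (· / s)`, `b (· / s)` of a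
vortex profile, with respect to `log r`, together with a primitive `K` of `q`. -/
structure IsCalibration (f b p q K : ℝ → ℝ) : Prop where
  surj_f : ∀ t ∈ Ioo (0 : ℝ) 1, ∃ r, 0 < r ∧ f r = t
  surj_b : ∀ t ∈ Ioo (0 : ℝ) 1, ∃ r, 0 < r ∧ b r = t
  cont_p : Continuous p
  p_f : ∀ r, 0 < r → p (f r) = r * deriv f r
  p_zero : ∀ t, t ∉ Ioo (0 : ℝ) 1 → p t = 0
  cont_q : Continuous q
  q_b : ∀ r, 0 < r → q (b r) = r * deriv b r
  q_zero : ∀ t, t ∉ Ioo (0 : ℝ) 1 → q t = 0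
  dK : ∀ s, HasDerivAt K (q s) s
  K_nonneg : ∀ s, 0 ≤ K s
  K_le_one : ∀ s, K s ≤ 1
  K_le : ∀ s, K s ≤ (1 - s) ^ 2
  K_of_nonpos : ∀ s, s ≤ 0 → K s = K 0
  K_of_one_le : ∀ s, 1 ≤ s → K s = 0

/-- Monotonicity makes the slopes functions of the values, and the vanishing of `r f'` and `r b'` at
both ends makes their extensions by zero continuous. The bound `r |b'| ≤ 2 (1 - b)` integrates to `K
s ≤ (1 - s) ^ 2`. -/
lemma IsVortex.exists_isCalibration {N lam : ℝ} {f b : ℝ → ℝ} (h : IsVortex N lam f b)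
    (hN : 1 ≤ N) (hlam : 0 < lam) : ∃ p q K, IsCalibration f b p q K := by
  obtain ⟨hsf, p, hp, hpf, hp0⟩ := exists_continuous_factor (h.strictMonoOn_f hN hlam)
    h.continuousOn_f (fun r hr => ⟨h.f_pos hN hlam hr, h.f_lt_one hN hlam hr⟩)
    (h.tendsto_f_zero hN hlam) (h.tendsto_f_atTop hN hlam)
    (fun r hr => (h.hasDerivAt_mul_deriv_f hr).continuousAt.continuousWithinAt)
    (h.tendsto_mul_deriv_f_zero hN hlam) (h.tendsto_mul_deriv_f_atTop hN hlam)
  obtain ⟨hsb, q₁, hq₁, hqb, hq0⟩ := exists_continuous_factor (φ := fun r => 1 - b r)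
    (ψ := fun r => r * deriv b r)
    (fun r hr s hs hrs => sub_lt_sub_left (h.strictAntiOn_b hr hs hrs) 1)
    (continuousOn_const.sub h.continuousOn_b)
    (fun r hr => ⟨by linarith [h.b_lt_one hr], by linarith [h.b_pos hr]⟩)
    (by simpa using h.tendsto_b_zero.const_sub 1)
    (by simpa using (h.tendsto_b_atTop hN hlam).const_sub 1)
    (fun r hr => ((hasDerivAt_id r).mul (h.ddb r hr)).continuousAt.continuousWithinAt)
    h.tendsto_mul_deriv_b_zero h.tendsto_mul_deriv_b_atTop
  have hsb' : ∀ t ∈ Ioo (0 : ℝ) 1, ∃ r, 0 < r ∧ b r = t := fun t ht => by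
    obtain ⟨r, hr, hr'⟩ := hsb (1 - t) ⟨by linarith [ht.2], by linarith [ht.1]⟩
    exact ⟨r, hr, by linarith⟩
  set q : ℝ → ℝ := fun s => q₁ (1 - s) with hq
  have hqc : Continuous q := hq₁.comp (continuous_const.sub continuous_id)
  have hqb' : ∀ r, 0 < r → q (b r) = r * deriv b r := fun r hr => hqb r hr
  have hq0' : ∀ t, t ∉ Ioo (0 : ℝ) 1 → q t = 0 := fun t ht =>
    hq0 _ fun h1 => ht ⟨by linarith [h1.2], by linarith [h1.1]⟩
  have hq1 : ∀ t, q t ≤ 0 := by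
    intro t
    by_cases ht : t ∈ Ioo (0 : ℝ) 1
    · obtain ⟨r, hr, rfl⟩ := hsb' t ht
      rw [hqb' r hr]
      exact mul_nonpos_of_nonneg_of_nonpos hr.le (h.deriv_b_neg hr).le
    · rw [hq0' t ht]
  have hq2 : ∀ t, t ≤ 1 → 0 ≤ q t + 2 * (1 - t) := by
    intro t ht1
    by_cases ht : t ∈ Ioo (0 : ℝ) 1
    · obtain ⟨r, hr, rfl⟩ := hsb' t ht
      rw [hqb' r hr]
      linarith [h.neg_mul_deriv_b_le hr]
    · rw [hq0' t ht]; linarith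
  -- Starting the primitive at 1, the value of `b` at the origin, is what keeps `K(d) / r ^ 2` small
  -- as `r → 0`.
  set K : ℝ → ℝ := fun s => ∫ x in (1 : ℝ)..s, q x with hK
  have hdK : ∀ s, HasDerivAt K (q s) s := fun s =>
    intervalIntegral.integral_hasDerivAt_right (hqc.intervalIntegrable _ _)
      (hqc.stronglyMeasurableAtFilter _ _) hqc.continuousAt
  have hanti : AntitoneOn K univ :=
    antitoneOn_of_hasDerivAt_nonpos convex_univ (fun s _ => hdK s) fun s _ => hq1 s
  have hK1 : K 1 = 0 := intervalIntegral.integral_same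
  have hKone : ∀ s, 1 ≤ s → K s = 0 := by
    intro s hs
    rw [← hK1]
    refine le_antisymm (hanti (mem_univ _) (mem_univ _) hs) ?_
    exact monotoneOn_of_hasDerivAt_nonneg (convex_Ici 1) (fun s _ => hdK s)
      (fun t ht => (hq0' t fun h1 => not_lt.2 ht h1.2).ge) self_mem_Ici hs hs
  have hKneg : ∀ s, s ≤ 0 → K s = K 0 := by
    intro s hs
    refine le_antisymm ?_ (hanti (mem_univ _) (mem_univ _) hs)
    exact monotoneOn_of_hasDerivAt_nonneg (convex_Iic 0) (fun s _ => hdK s)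
      (fun t ht => (hq0' t fun h1 => not_lt.2 ht h1.1).ge) hs self_mem_Iic hs
  have hK0 : ∀ s, 0 ≤ K s := by
    intro s
    rcases le_total s 1 with hs | hs
    · rw [← hK1]; exact hanti (mem_univ _) (mem_univ _) hs
    · exact (hKone s hs).ge
  have hKle : ∀ s, K s ≤ (1 - s) ^ 2 := by
    intro s
    rcases le_total s 1 with hs | hs
    · have hm : MonotoneOn (fun s => K s - (1 - s) ^ 2) (Iic 1) :=
        monotoneOn_of_hasDerivAt_nonneg (g' := fun s => q s + 2 * (1 - s)) (convex_Iic 1)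
          (fun s _ => ((hdK s).sub (((hasDerivAt_id s).const_sub 1).pow 2)).congr_deriv
            (by simp)) hq2
      have : K s - (1 - s) ^ 2 ≤ K 1 - (1 - 1) ^ 2 := hm hs self_mem_Iic hs
      rw [hK1] at this; linarith
    · rw [hKone s hs]; positivity
  refine ⟨p, q, K, hsf, hsb', hp, hpf, hp0, hqc, hqb', hq0', hdK, hK0, fun s => ?_, hKle, hKneg,
    hKone⟩
  have h0 : K 0 ≤ 1 := by simpa using hKle 0
  rcases le_total s 0 with hs | hs
  · rwa [hKneg s hs]
  · exact (hanti (mem_univ _) (mem_univ _) hs).trans h0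

/-! ### Pointwise minimality of the reduced density. -/

/-- The part of the radial energy density (with respect to `dr / r`) left over when the null
Lagrangian of the calibration is subtracted. -/
def reducedDensity (N lam : ℝ) (p q K : ℝ → ℝ) (r t s : ℝ) : ℝ :=
  -p |t| ^ 2 + N * t ^ 2 * s ^ 2 + lam / 4 * (t ^ 2 - 1) ^ 2 * r ^ 2
    + N / r ^ 2 * (4 * K s - q s ^ 2)

section
variable {N lam : ℝ} {f b p q K : ℝ → ℝ}

/-- In the coordinates `(f y, b z)` the slopes become `y f'(y)` and `z b'(z)`, so the reduced
density can be differentiated through the vortex equations without any differentiability of `p` or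
`q`. -/
lemma reducedDensity_leaf (hv : IsVortex N lam f b) (hN : 1 ≤ N) (hlam : 0 < lam)
    (hc : IsCalibration f b p q K) {r y z : ℝ} (hy : 0 < y) (hz : 0 < z) :
    reducedDensity N lam p q K r (f y) (b z) =
      (-(y * deriv f y) ^ 2 + lam / 4 * (f y ^ 2 - 1) ^ 2 * r ^ 2) + N * f y ^ 2 * b z ^ 2
        + N / r ^ 2 * (4 * K (b z) - (z * deriv b z) ^ 2) := by
  rw [reducedDensity, abs_of_pos (hv.f_pos hN hlam hy), hc.p_f y hy, hc.q_b z hz]; ring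

lemma hasDerivAt_reducedDensity_left (hv : IsVortex N lam f b) (hN : 1 ≤ N) (hlam : 0 < lam)
    (hc : IsCalibration f b p q K) {r y z : ℝ} (hy : 0 < y) (hz : 0 < z) :
    HasDerivAt (fun y => reducedDensity N lam p q K r (f y) (b z))
      (2 * f y * deriv f y * (N * (b z ^ 2 - b y ^ 2)
        - lam / 2 * (1 - f y ^ 2) * (r ^ 2 - y ^ 2))) y := by
  have h1 := hv.df y hy
  have h2 : HasDerivAt (fun y => (-(y * deriv f y) ^ 2 + lam / 4 * (f y ^ 2 - 1) ^ 2 * r ^ 2)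
      + N * f y ^ 2 * b z ^ 2 + N / r ^ 2 * (4 * K (b z) - (z * deriv b z) ^ 2)) _ y :=
    (((((hv.hasDerivAt_mul_deriv_f hy).pow 2).neg).add
      (((((h1.pow 2).sub_const 1).pow 2).const_mul (lam / 4)).mul_const (r ^ 2))).add
      (((h1.pow 2).const_mul N).mul_const (b z ^ 2))).add_const _
  refine (h2.congr_of_eventuallyEq ?_).congr_deriv ?_
  · filter_upwards [Ioi_mem_nhds hy] with x hx using reducedDensity_leaf hv hN hlam hc hx hz
  · simp
    field_simp; ring

lemma hasDerivAt_reducedDensity_right (hv : IsVortex N lam f b) (hN : 1 ≤ N) (hlam : 0 < lam)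
    (hc : IsCalibration f b p q K) {r y z : ℝ} (hr : 0 < r) (hy : 0 < y) (hz : 0 < z) :
    HasDerivAt (fun z => reducedDensity N lam p q K r (f y) (b z))
      (2 * N * b z * deriv b z * (f y ^ 2 - z ^ 2 / r ^ 2 * f z ^ 2)) z := by
  have h1 := hv.db z hz
  have h2 : HasDerivAt (fun z => (-(y * deriv f y) ^ 2 + lam / 4 * (f y ^ 2 - 1) ^ 2 * r ^ 2)
      + N * f y ^ 2 * b z ^ 2 + N / r ^ 2 * (4 * K (b z) - (z * deriv b z) ^ 2)) _ z :=
    (((h1.pow 2).const_mul (N * f y ^ 2)).const_add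
      (-(y * deriv f y) ^ 2 + lam / 4 * (f y ^ 2 - 1) ^ 2 * r ^ 2)).add
      (((((hc.dK (b z)).comp z h1).const_mul 4).sub
        (((hasDerivAt_id z).mul (hv.ddb z hz)).pow 2)).const_mul (N / r ^ 2))
  refine (h2.congr_of_eventuallyEq ?_).congr_deriv ?_
  · filter_upwards [Ioi_mem_nhds hz] with x hx using reducedDensity_leaf hv hN hlam hc hy hx
  · simp [hc.q_b z hz]
    field_simp; ring

lemma hasDerivAt_reducedDensity_diag (hv : IsVortex N lam f b) (hN : 1 ≤ N) (hlam : 0 < lam)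
    (hc : IsCalibration f b p q K) {r y : ℝ} (hr : 0 < r) (hy : 0 < y) :
    HasDerivAt (fun y => reducedDensity N lam p q K r (f y) (b y))
      ((lam * f y * deriv f y * (1 - f y ^ 2) - 2 * N * b y * deriv b y * f y ^ 2 / r ^ 2)
        * (y ^ 2 - r ^ 2)) y := by
  have h1 := hv.df y hy
  have h3 := hv.db y hy
  have h2 : HasDerivAt (fun y => (-(y * deriv f y) ^ 2 + lam / 4 * (f y ^ 2 - 1) ^ 2 * r ^ 2)
      + N * f y ^ 2 * b y ^ 2 + N / r ^ 2 * (4 * K (b y) - (y * deriv b y) ^ 2)) _ y :=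
    (((((hv.hasDerivAt_mul_deriv_f hy).pow 2).neg).add
      (((((h1.pow 2).sub_const 1).pow 2).const_mul (lam / 4)).mul_const (r ^ 2))).add
      (((h1.pow 2).const_mul N).mul (h3.pow 2))).add
      (((((hc.dK (b y)).comp y h3).const_mul 4).sub
        (((hasDerivAt_id y).mul (hv.ddb y hy)).pow 2)).const_mul (N / r ^ 2))
  refine (h2.congr_of_eventuallyEq ?_).congr_deriv ?_
  · filter_upwards [Ioi_mem_nhds hy] with x hx using reducedDensity_leaf hv hN hlam hc hx hx
  · simp [hc.q_b y hy]
    field_simp; ring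

/-- Along `y = z` the derivative is a nonnegative coefficient times `y ^ 2 - r ^ 2`, so the minimum
lies at `y = r`. -/
lemma reducedDensity_diag_le (hv : IsVortex N lam f b) (hN : 1 ≤ N) (hlam : 0 < lam)
    (hc : IsCalibration f b p q K) {r y : ℝ} (hr : 0 < r) (hy : 0 < y) :
    reducedDensity N lam p q K r (f r) (b r) ≤ reducedDensity N lam p q K r (f y) (b y) := by
  have hcoef : ∀ x, 0 < x →
      0 ≤ lam * f x * deriv f x * (1 - f x ^ 2) - 2 * N * b x * deriv b x * f x ^ 2 / r ^ 2 := by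
    intro x hx
    have h1 := hv.f_pos hN hlam hx
    have h2 := hv.deriv_f_nonneg hN hlam hx
    have h3 : 0 ≤ 1 - f x ^ 2 := (sub_pos.2 (hv.f_sq_lt_one hN hlam hx)).le
    have h4 := hv.b_pos hx
    have h5 : 0 ≤ -deriv b x := by linarith [hv.deriv_b_neg hx]
    have h6 : 0 ≤ lam * f x * deriv f x * (1 - f x ^ 2) := by positivity
    have h7 : 0 ≤ 2 * N * b x * (-deriv b x) * f x ^ 2 / r ^ 2 := by positivity
    have e : 2 * N * b x * (-deriv b x) * f x ^ 2 / r ^ 2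
        = -(2 * N * b x * deriv b x * f x ^ 2 / r ^ 2) := by ring
    linarith
  rcases le_total r y with hry | hry
  · refine monotoneOn_of_hasDerivAt_nonneg (convex_Icc r y)
      (fun x hx => hasDerivAt_reducedDensity_diag hv hN hlam hc hr (hr.trans_le hx.1))
      (fun x hx => mul_nonneg (hcoef x (hr.trans_le hx.1)) ?_) (left_mem_Icc.2 hry)
      (right_mem_Icc.2 hry) hry
    nlinarith [hx.1]
  · refine antitoneOn_of_hasDerivAt_nonpos (convex_Icc y r)
      (fun x hx => hasDerivAt_reducedDensity_diag hv hN hlam hc hr (hy.trans_le hx.1))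
      (fun x hx => mul_nonpos_of_nonneg_of_nonpos (hcoef x (hy.trans_le hx.1)) ?_)
      (left_mem_Icc.2 hry) (right_mem_Icc.2 hry) hry
    nlinarith [hx.1, hx.2]

/-- Follow the diagonal from `r` down to `y`, then lower `z`: for `x ≤ y ≤ r` one has `x f x ≤ r f
y`, so the `z`-derivative is nonpositive. -/
lemma reducedDensity_le_of_le_le (hv : IsVortex N lam f b) (hN : 1 ≤ N) (hlam : 0 < lam)
    (hc : IsCalibration f b p q K) {r y z : ℝ} (hr : 0 < r) (hz : 0 < z) (hzy : z ≤ y)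
    (hyr : y ≤ r) :
    reducedDensity N lam p q K r (f r) (b r) ≤ reducedDensity N lam p q K r (f y) (b z) := by
  have hy : 0 < y := hz.trans_le hzy
  refine (reducedDensity_diag_le hv hN hlam hc hr hy).trans ?_
  refine antitoneOn_of_hasDerivAt_nonpos (convex_Icc z y)
    (fun x hx => hasDerivAt_reducedDensity_right hv hN hlam hc hr hy (hz.trans_le hx.1))
    (fun x hx => ?_) (left_mem_Icc.2 hzy) (right_mem_Icc.2 hzy) hzy
  have hx0 := hz.trans_le hx.1
  have h1 : f x ≤ f y := (hv.strictMonoOn_f hN hlam).monotoneOn hx0 hy hx.2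
  have h2 := hv.f_pos hN hlam hx0
  have h3 : x ^ 2 / r ^ 2 ≤ 1 := by
    rw [div_le_one (by positivity)]
    have := hx.2.trans hyr
    gcongr
  have h4 : x ^ 2 / r ^ 2 * f x ^ 2 ≤ 1 * f y ^ 2 := by gcongr
  have h5 := hv.b_pos hx0
  refine mul_nonpos_of_nonpos_of_nonneg
    (mul_nonpos_of_nonneg_of_nonpos (by positivity) (hv.deriv_b_neg hx0).le) ?_
  linarith

lemma reducedDensity_le_of_ge_ge (hv : IsVortex N lam f b) (hN : 1 ≤ N) (hlam : 0 < lam)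
    (hc : IsCalibration f b p q K) {r y z : ℝ} (hr : 0 < r) (hry : r ≤ y) (hyz : y ≤ z) :
    reducedDensity N lam p q K r (f r) (b r) ≤ reducedDensity N lam p q K r (f y) (b z) := by
  have hy : 0 < y := hr.trans_le hry
  refine (reducedDensity_diag_le hv hN hlam hc hr hy).trans ?_
  refine monotoneOn_of_hasDerivAt_nonneg (convex_Icc y z)
    (fun x hx => hasDerivAt_reducedDensity_right hv hN hlam hc hr hy (hy.trans_le hx.1))
    (fun x hx => ?_) (left_mem_Icc.2 hyz) (right_mem_Icc.2 hyz) hyz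
  have hx0 := hy.trans_le hx.1
  have h1 : f y ≤ f x := (hv.strictMonoOn_f hN hlam).monotoneOn hy hx0 hx.1
  have h2 := hv.f_pos hN hlam hy
  have h3 : 1 ≤ x ^ 2 / r ^ 2 := by
    rw [one_le_div (by positivity)]
    have := hry.trans hx.1
    gcongr
  have h4 : 1 * f y ^ 2 ≤ x ^ 2 / r ^ 2 * f x ^ 2 := by gcongr
  have h5 := hv.b_pos hx0
  refine mul_nonneg_of_nonpos_of_nonpos
    (mul_nonpos_of_nonneg_of_nonpos (by positivity) (hv.deriv_b_neg hx0).le) ?_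
  linarith

/-- In the two regions not covered by the path lemmas, vary `y` with `z` fixed. Beyond `max z r`, or
below `min z r`, both terms of the `y`-derivative have the same sign, and the endpoint `y = max z r`
or `y = min z r` falls under an earlier case. -/
lemma reducedDensity_leaf_le (hv : IsVortex N lam f b) (hN : 1 ≤ N) (hlam : 0 < lam)
    (hc : IsCalibration f b p q K) {r y z : ℝ} (hr : 0 < r) (hy : 0 < y) (hz : 0 < z) :
    reducedDensity N lam p q K r (f r) (b r) ≤ reducedDensity N lam p q K r (f y) (b z) := by
  have hpre : ∀ x, 0 < x → 0 ≤ 2 * f x * deriv f x := fun x hx => by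
    have := hv.f_pos hN hlam hx
    have := hv.deriv_f_nonneg hN hlam hx
    positivity
  have hpot : ∀ x, 0 < x → 0 ≤ lam / 2 * (1 - f x ^ 2) := fun x hx => by
    have := hv.f_sq_lt_one hN hlam hx
    have : 0 ≤ 1 - f x ^ 2 := by linarith
    positivity
  rcases le_total z y with hzy | hyz
  · rcases le_total y r with hyr | hry
    · exact reducedDensity_le_of_le_le hv hN hlam hc hr hz hzy hyr
    have hmy : max z r ≤ y := max_le hzy hry
    have hm0 : 0 < max z r := lt_max_of_lt_left hz
    refine le_trans ?_ (monotoneOn_of_hasDerivAt_nonneg (convex_Icc (max z r) y)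
      (fun x hx => hasDerivAt_reducedDensity_left hv hN hlam hc (hm0.trans_le hx.1) hz)
      (fun x hx => ?_) (left_mem_Icc.2 hmy) (right_mem_Icc.2 hmy) hmy)
    · rcases le_total z r with hzr | hrz
      · rw [max_eq_right hzr]
        exact reducedDensity_le_of_le_le hv hN hlam hc hr hz hzr le_rfl
      · rw [max_eq_left hrz]
        exact reducedDensity_diag_le hv hN hlam hc hr hz
    · have hx0 := hm0.trans_le hx.1
      have h1 : b x ≤ b z := hv.strictAntiOn_b.antitoneOn hz hx0 ((le_max_left _ _).trans hx.1)
      have h2 : r ≤ x := (le_max_right _ _).trans hx.1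
      have h3 := hv.b_pos hx0
      have h4 : 0 ≤ N * (b z ^ 2 - b x ^ 2) := mul_nonneg (by linarith) (by nlinarith)
      have h5 := mul_nonneg (hpot x hx0) (show 0 ≤ x ^ 2 - r ^ 2 by nlinarith)
      exact mul_nonneg (hpre x hx0) (by nlinarith)
  · rcases le_total r y with hry | hyr
    · exact reducedDensity_le_of_ge_ge hv hN hlam hc hr hry hyz
    have hmy : y ≤ min z r := le_min hyz hyr
    refine le_trans ?_ (antitoneOn_of_hasDerivAt_nonpos (convex_Icc y (min z r))
      (fun x hx => hasDerivAt_reducedDensity_left hv hN hlam hc (hy.trans_le hx.1) hz)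
      (fun x hx => ?_) (left_mem_Icc.2 hmy) (right_mem_Icc.2 hmy) hmy)
    · rcases le_total z r with hzr | hrz
      · rw [min_eq_left hzr]
        exact reducedDensity_diag_le hv hN hlam hc hr hz
      · rw [min_eq_right hrz]
        exact reducedDensity_le_of_ge_ge hv hN hlam hc hr le_rfl hrz
    · have hx0 := hy.trans_le hx.1
      have h1 : b z ≤ b x := hv.strictAntiOn_b.antitoneOn hx0 hz (hx.2.trans (min_le_left _ _))
      have h2 : x ≤ r := hx.2.trans (min_le_right _ _)
      have h3 := hv.b_pos hz
      have h4 : 0 ≤ N * (b x ^ 2 - b z ^ 2) := mul_nonneg (by linarith) (by nlinarith)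
      have h5 := mul_nonneg (hpot x hx0) (show 0 ≤ r ^ 2 - x ^ 2 by nlinarith)
      exact mul_nonpos_of_nonneg_of_nonpos (hpre x hx0) (by nlinarith)

/-- At every radius the reduced density is minimal at the values of the vortex profile. -/
lemma reducedDensity_le (hv : IsVortex N lam f b) (hN : 1 ≤ N) (hlam : 0 < lam)
    (hc : IsCalibration f b p q K) {r : ℝ} (hr : 0 < r) (t s : ℝ) :
    reducedDensity N lam p q K r (f r) (b r) ≤ reducedDensity N lam p q K r t s := by
  have hcp := hc.cont_p
  have hcq := hc.cont_q
  have hcK : Continuous K := continuous_iff_continuousAt.2 fun s => (hc.dK s).continuousAt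
  have hcont : Continuous fun x : ℝ × ℝ => reducedDensity N lam p q K r x.1 x.2 := by
    unfold reducedDensity; fun_prop
  have hcl : IsClosed {x : ℝ × ℝ | reducedDensity N lam p q K r (f r) (b r) ≤
      reducedDensity N lam p q K r x.1 x.2} := isClosed_le continuous_const hcont
  have hsub : Ioo (0 : ℝ) 1 ×ˢ Ioo (0 : ℝ) 1 ⊆ {x : ℝ × ℝ |
      reducedDensity N lam p q K r (f r) (b r) ≤ reducedDensity N lam p q K r x.1 x.2} := by
    rintro ⟨t, s⟩ ⟨ht, hs⟩
    obtain ⟨y, hy, rfl⟩ := hc.surj_f t ht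
    obtain ⟨z, hz, rfl⟩ := hc.surj_b s hs
    exact reducedDensity_leaf_le hv hN hlam hc hr hy hz
  have hsub' := closure_minimal hsub hcl
  rw [closure_prod_eq, closure_Ioo (by norm_num)] at hsub'
  have hbox : ∀ t ∈ Icc (0 : ℝ) 1, ∀ s ∈ Icc (0 : ℝ) 1,
      reducedDensity N lam p q K r (f r) (b r) ≤ reducedDensity N lam p q K r t s :=
    fun t ht s hs => hsub' (show (t, s) ∈ _ from ⟨ht, hs⟩)
  -- Truncating to the unit square leaves the `p`, `q` and `K` terms unchanged and does not increase
  -- the others.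
  have ht' : min |t| 1 ∈ Icc (0 : ℝ) 1 := ⟨le_min (abs_nonneg _) zero_le_one, min_le_right _ _⟩
  have hs' : max 0 (min s 1) ∈ Icc (0 : ℝ) 1 :=
    ⟨le_max_left _ _, max_le zero_le_one (min_le_right _ _)⟩
  refine (hbox _ ht' _ hs').trans ?_
  have e1 : p |min (|t|) 1| = p |t| ∧ (min |t| 1) ^ 2 ≤ t ^ 2 ∧
      ((min |t| 1) ^ 2 - 1) ^ 2 ≤ (t ^ 2 - 1) ^ 2 := by
    rcases le_total |t| 1 with h1 | h1
    · rw [min_eq_left h1, abs_abs, sq_abs]; exact ⟨rfl, le_rfl, le_rfl⟩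
    · rw [min_eq_right h1, abs_one, hc.p_zero 1 (by simp), hc.p_zero |t| fun h2 => by
        linarith [h2.2]]
      refine ⟨rfl, ?_, ?_⟩
      · rw [← sq_abs t]; nlinarith
      · norm_num; positivity
  have e2 : K (max 0 (min s 1)) = K s ∧ q (max 0 (min s 1)) = q s ∧
      (max 0 (min s 1)) ^ 2 ≤ s ^ 2 := by
    rcases le_total s 0 with h1 | h1
    · rw [min_eq_left (h1.trans zero_le_one), max_eq_left h1, hc.K_of_nonpos s h1,
        hc.q_zero 0 (by simp), hc.q_zero s fun h2 => by linarith [h2.1]]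
      exact ⟨rfl, rfl, by nlinarith⟩
    · rcases le_total s 1 with h2 | h2
      · rw [min_eq_left h2, max_eq_right h1]; exact ⟨rfl, rfl, le_rfl⟩
      · rw [min_eq_right h2, max_eq_right zero_le_one, hc.K_of_one_le s h2,
          hc.K_of_one_le 1 le_rfl, hc.q_zero 1 (by simp), hc.q_zero s fun h3 => by linarith [h3.2]]
        exact ⟨rfl, rfl, by nlinarith⟩
  obtain ⟨a1, a2, a3⟩ := e1
  obtain ⟨b1, b2, b3⟩ := e2
  unfold reducedDensity
  rw [a1, b1, b2]
  have hN0 : 0 ≤ N := by linarith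
  gcongr

end

/-! ### Translation between the radial class and weighted integrals. -/

/-- The radial energy density with respect to `dr`, in terms of `d = 1 - a` and `N = n ^ 2`. -/
def energyDensity (N lam : ℝ) (g d : ℝ → ℝ) (r : ℝ) : ℝ :=
  r * (deriv g r ^ 2 + N * (d r ^ 2 * g r ^ 2 / r ^ 2) + N * (deriv d r ^ 2 / r ^ 2)
    + lam / 4 * (g r ^ 2 - 1) ^ 2)

lemma radialEnergy_eq (n : ℤ) (lam : ℝ) (g c : ℝ → ℝ) :
    radialEnergy n lam g c = (1 / 2) * ∫⁻ r in Ioi 0,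
      ENNReal.ofReal (energyDensity ((n : ℝ) ^ 2) lam g (fun r => 1 - c r) r) := by
  unfold radialEnergy radialMeasure
  rw [lintegral_withDensity_eq_lintegral_mul_non_measurable _ ENNReal.measurable_ofReal
    (ae_of_all _ fun _ => ENNReal.ofReal_lt_top)]
  congr 1
  refine setLIntegral_congr_fun measurableSet_Ioi fun r hr => ?_
  have hr0 : (0 : ℝ) ≤ r := le_of_lt hr
  simp only [Pi.mul_apply]
  rw [← ENNReal.ofReal_mul hr0, energyDensity, deriv_const_sub, neg_sq]

lemma energyDensity_nonneg {N lam : ℝ} (hN : 0 ≤ N) (hlam : 0 < lam) (g d : ℝ → ℝ) {r : ℝ}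
    (hr : 0 < r) : 0 ≤ energyDensity N lam g d r := by
  unfold energyDensity; positivity

lemma integrableOn_of_memLp {u : ℝ → ℝ} {s : Set ℝ} (hs : MeasurableSet s)
    (h : MemLp u 2 (radialMeasure.restrict s)) :
    IntegrableOn (fun r => u r ^ 2 * r) (Ioi 0 ∩ s) := by
  have h1 := h.integrable_sq
  unfold radialMeasure at h1
  rw [restrict_withDensity hs, Measure.restrict_restrict hs, inter_comm,
    integrable_withDensity_iff ENNReal.measurable_ofReal
      (ae_of_all _ fun _ => ENNReal.ofReal_lt_top)] at h1
  refine IntegrableOn.congr_fun h1 (fun r hr => ?_) (measurableSet_Ioi.inter hs)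
  have hr0 : (0 : ℝ) ≤ r := le_of_lt hr.1
  simp only [ENNReal.toReal_ofReal hr0]

/-- The properties of competitors `(g, 1 - d)` in the radial class. -/
structure IsProfile (g d : ℝ → ℝ) : Prop where
  acg : LocallyAC g
  acd : LocallyAC d
  int_dg : IntegrableOn (fun r => deriv g r ^ 2 * r) (Ioi 0)
  int_g : IntegrableOn (fun r => (1 - g r) ^ 2 * r) (Ioi 0)
  int_d : IntegrableOn (fun r => ((1 - d r) / r) ^ 2 * r) (Ioc 0 1)
  int_dd : IntegrableOn (fun r => (deriv d r / r) ^ 2 * r) (Ioi 0)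

lemma isProfile_of_mem {g c : ℝ → ℝ} (h : (g, c) ∈ radialClass) :
    IsProfile g fun r => 1 - c r := by
  obtain ⟨⟨h1, h2, h3⟩, h4, h5, h6⟩ := h
  have key : ∀ u : ℝ → ℝ, MemLp u 2 radialMeasure →
      IntegrableOn (fun r => u r ^ 2 * r) (Ioi 0) := fun u hu => by
    have := integrableOn_of_memLp MeasurableSet.univ (u := u) (by rwa [Measure.restrict_univ])
    rwa [inter_univ] at this
  refine ⟨by simpa using h1.one_sub, h4.one_sub, ?_, key _ h2, ?_, ?_⟩
  · simpa [deriv_const_sub] using key _ h3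
  · have := integrableOn_of_memLp measurableSet_Ioc (h5 1 one_pos)
    rw [inter_eq_right.2 Ioc_subset_Ioi_self] at this
    simpa using this
  · simpa [deriv_const_sub, neg_div] using key _ h6

lemma isVortex_of_solves {n : ℤ} {lam : ℝ} {f a : ℝ → ℝ} (hmem : (f, a) ∈ radialClass)
    (hsol : SolvesVortexODE n lam f a) : IsVortex ((n : ℝ) ^ 2) lam f fun r => 1 - a r := by
  have hp := isProfile_of_mem hmem
  have hd : ∀ u : ℝ → ℝ, ContDiffOn ℝ 2 u (Ioi 0) → ∀ r, 0 < r →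
      HasDerivAt u (deriv u r) r ∧ HasDerivAt (deriv u) (deriv (deriv u) r) r := by
    intro u hu r hr
    have hm : Ioi (0 : ℝ) ∈ 𝓝 r := Ioi_mem_nhds hr
    have h1 : ContDiffOn ℝ 1 (deriv u) (Ioi 0) := hu.deriv_of_isOpen isOpen_Ioi (by norm_num)
    exact ⟨((hu.differentiableOn (by norm_num)).differentiableAt hm).hasDerivAt,
      ((h1.differentiableOn (by norm_num)).differentiableAt hm).hasDerivAt⟩
  have hda : deriv (fun r => 1 - a r) = fun r => -deriv a r := by
    ext r; rw [deriv_const_sub]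
  refine ⟨fun r hr => (hd f hsol.contDiffOn_f r hr).1, fun r hr => ?_, fun r hr => ?_,
    fun r hr => ?_, hp.acd, hp.int_dg, hp.int_g, hp.int_d, hp.int_dd⟩
  · refine (hd f hsol.contDiffOn_f r hr).2.congr_deriv ?_
    have := hsol.eq_f r hr
    unfold radialLaplacian at this
    linear_combination -this
  · rw [hda]
    exact (hd a hsol.contDiffOn_a r hr).1.const_sub 1
  · rw [hda]
    refine (hd a hsol.contDiffOn_a r hr).2.neg.congr_deriv ?_
    have := hsol.eq_a r hr
    linear_combination this

lemma LocallyAC.continuousOn {u : ℝ → ℝ} (h : LocallyAC u) : ContinuousOn u (Ioi 0) := by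
  intro r hr
  have hr0 : 0 < r := hr
  have := (h (r / 2) (r + 1) (by positivity) (by linarith)).continuousOn
  rw [uIcc_of_le (by linarith)] at this
  exact (this.continuousAt (Icc_mem_nhds (by linarith) (by linarith))).continuousWithinAt

/-! ### The null Lagrangian and the calibration inequality. -/

section Calibration

/-- The null Lagrangian of the calibration. -/
def nullLagrangian (N : ℝ) (p K g d : ℝ → ℝ) (r : ℝ) : ℝ :=
  2 * (∫ x in (0 : ℝ)..g r, p |x|) + 2 * N * (K (d r) * (r ^ 2)⁻¹)

variable {N lam : ℝ} {f b p q K : ℝ → ℝ}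

lemma IsCalibration.hasDerivAt_primitive (hc : IsCalibration f b p q K) (t : ℝ) :
    HasDerivAt (fun t => ∫ x in (0 : ℝ)..t, p |x|) (p |t|) t := by
  have h1 : Continuous fun x => p |x| := hc.cont_p.comp continuous_abs
  exact intervalIntegral.integral_hasDerivAt_right (h1.intervalIntegrable _ _)
    (h1.stronglyMeasurableAtFilter _ _) h1.continuousAt

/-- This is the completion of squares: the cross terms `2 p g'` and `2 N q d' / r ^ 2` are exact
derivatives, except that differentiating `r ^ (-2)` produces the `4 K` term of the reduced density.
-/
lemma hasDerivAt_nullLagrangian (hc : IsCalibration f b p q K) {g d : ℝ → ℝ} {r : ℝ} (hr : 0 < r)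
    (hg : DifferentiableAt ℝ g r) (hd : DifferentiableAt ℝ d r) :
    HasDerivAt (nullLagrangian N p K g d)
      (energyDensity N lam g d r - r * (deriv g r - p |g r| / r) ^ 2
        - N / r * (deriv d r - q (d r) / r) ^ 2
        - reducedDensity N lam p q K r (g r) (d r) / r) r := by
  have h1 := ((hc.hasDerivAt_primitive (g r)).comp r hg.hasDerivAt).const_mul 2
  have h2 := ((((hc.dK (d r)).comp r hd.hasDerivAt).mul
    (((hasDerivAt_id r).pow 2).inv (by simpa using hr.ne'))).const_mul (2 * N))
  refine (h1.add h2).congr_deriv ?_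
  simp only [energyDensity, reducedDensity, id, Function.comp_apply, Pi.pow_apply, Pi.inv_apply]
  field_simp
  ring

lemma lipschitz_of_deriv_vanishing {P Q : ℝ → ℝ} (hP : ∀ t, HasDerivAt P (Q t) t)
    (hQ : Continuous Q) (h0 : ∀ t, 1 < |t| → Q t = 0) : ∃ C, LipschitzWith C P := by
  obtain ⟨C, hC⟩ := (isCompact_Icc (a := (-1 : ℝ)) (b := 1)).exists_bound_of_continuousOn
    hQ.continuousOn
  refine ⟨C.toNNReal, lipschitzWith_of_nnnorm_deriv_le (fun t => (hP t).differentiableAt)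
    fun t => ?_⟩
  rw [(hP t).deriv, ← NNReal.coe_le_coe, coe_nnnorm]
  refine le_trans ?_ (Real.le_coe_toNNReal C)
  rcases le_or_gt |t| 1 with ht | ht
  · exact hC t (abs_le.1 ht)
  · rw [h0 t ht, norm_zero]
    exact (norm_nonneg _).trans (hC 0 (by norm_num))

lemma absolutelyContinuous_nullLagrangian (hc : IsCalibration f b p q K) {g d : ℝ → ℝ}
    (hg : LocallyAC g) (hd : LocallyAC d) {α β : ℝ} (hα : 0 < α) (hαβ : α ≤ β) :
    AbsolutelyContinuousOnInterval (nullLagrangian N p K g d) α β := by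
  obtain ⟨C₁, hC₁⟩ := lipschitz_of_deriv_vanishing hc.hasDerivAt_primitive
    (hc.cont_p.comp continuous_abs) fun t ht => hc.p_zero _ fun h1 => by linarith [h1.2]
  obtain ⟨C₂, hC₂⟩ := lipschitz_of_deriv_vanishing hc.dK hc.cont_q fun t ht =>
    hc.q_zero _ fun h1 => by rw [abs_of_pos h1.1] at ht; linarith [h1.2]
  have h3 : AbsolutelyContinuousOnInterval (fun r : ℝ => (r ^ 2)⁻¹) α β := by
    refine ContDiffOn.absolutelyContinuousOnInterval ?_
    rw [uIcc_of_le hαβ]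
    exact (contDiffOn_id.pow 2).inv fun r hr =>
      pow_ne_zero 2 (hα.trans_le hr.1).ne'
  exact (((hg α β hα hαβ).lipschitz_comp hC₁).const_mul 2).fun_add
    ((((hd α β hα hαβ).lipschitz_comp hC₂).fun_mul h3).const_mul (2 * N))

lemma IsVortex.energyDensity_eq (hv : IsVortex N lam f b) (hN : 1 ≤ N) (hlam : 0 < lam)
    (hc : IsCalibration f b p q K) {r : ℝ} (hr : 0 < r) :
    energyDensity N lam f b r = deriv (nullLagrangian N p K f b) r
      + reducedDensity N lam p q K r (f r) (b r) / r := by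
  rw [(hasDerivAt_nullLagrangian (lam := lam) hc hr (hv.df r hr).differentiableAt
    (hv.db r hr).differentiableAt).deriv, abs_of_pos (hv.f_pos hN hlam hr), hc.p_f r hr,
    hc.q_b r hr]
  field_simp
  ring

lemma IsVortex.continuousOn_energyDensity (hv : IsVortex N lam f b) :
    ContinuousOn (energyDensity N lam f b) (Ioi 0) := by
  have h1 := hv.continuousOn_f
  have h2 := hv.continuousOn_b
  have h3 : ContinuousOn (deriv f) (Ioi 0) :=
    fun r hr => (hv.ddf r hr).continuousAt.continuousWithinAt
  have h4 : ContinuousOn (deriv b) (Ioi 0) :=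
    fun r hr => (hv.ddb r hr).continuousAt.continuousWithinAt
  have h5 : ∀ r ∈ Ioi (0 : ℝ), r ^ 2 ≠ 0 := fun r hr => pow_ne_zero 2 (ne_of_gt hr)
  unfold energyDensity
  fun_prop (disch := assumption)

/-- The calibration inequality on an annulus. -/
lemma IsVortex.integral_energyDensity_le (hv : IsVortex N lam f b) (hf : LocallyAC f)
    (hN : 1 ≤ N) (hlam : 0 < lam)
    (hc : IsCalibration f b p q K) {g d : ℝ → ℝ} (hg : LocallyAC g) (hd : LocallyAC d)
    {α β : ℝ} (hα : 0 < α) (hαβ : α ≤ β)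
    (hint : IntervalIntegrable (energyDensity N lam g d) volume α β) :
    (∫ r in α..β, energyDensity N lam f b r)
      + (nullLagrangian N p K g d β - nullLagrangian N p K g d α)
      - (nullLagrangian N p K f b β - nullLagrangian N p K f b α)
      ≤ ∫ r in α..β, energyDensity N lam g d r := by
  have A1 := absolutelyContinuous_nullLagrangian (N := N) hc hg hd hα hαβ
  have A2 := absolutelyContinuous_nullLagrangian (N := N) hc hf hv.acb hα hαβ
  have I0 : IntervalIntegrable (energyDensity N lam f b) volume α β := by
    refine (hv.continuousOn_energyDensity.mono ?_).intervalIntegrable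
    rw [uIcc_of_le hαβ]
    exact fun r hr => hα.trans_le hr.1
  have I1 := A1.intervalIntegrable_deriv
  have I2 := A2.intervalIntegrable_deriv
  rw [← A1.integral_deriv_eq_sub, ← A2.integral_deriv_eq_sub,
    ← intervalIntegral.integral_add I0 I1, ← intervalIntegral.integral_sub (I0.add I1) I2]
  refine intervalIntegral.integral_mono_ae_restrict hαβ ((I0.add I1).sub I2) hint ?_
  filter_upwards [ae_restrict_mem measurableSet_Icc,
    ae_restrict_of_ae (hg α β hα hαβ).ae_differentiableAt,
    ae_restrict_of_ae (hd α β hα hαβ).ae_differentiableAt] with r hr h1 h2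
  rw [uIcc_of_le hαβ] at h1 h2
  have hr0 : 0 < r := hα.trans_le hr.1
  have h3 := (hasDerivAt_nullLagrangian (N := N) (lam := lam) hc hr0 (h1 hr) (h2 hr)).deriv
  have h4 := hv.energyDensity_eq hN hlam hc hr0
  have h5 : reducedDensity N lam p q K r (f r) (b r) / r
      ≤ reducedDensity N lam p q K r (g r) (d r) / r := by
    have := reducedDensity_le hv hN hlam hc hr0 (g r) (d r)
    gcongr
  have h6 : 0 ≤ r * (deriv g r - p |g r| / r) ^ 2 := by positivity
  have h7 : 0 ≤ N / r * (deriv d r - q (d r) / r) ^ 2 := by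
    have : 0 ≤ N := by linarith
    positivity
  rw [h3, h4]
  linarith

end Calibration

/-! ### Boundary terms and exhaustion of the half-line. -/

lemma IsProfile.aestronglyMeasurable_energyDensity {N lam : ℝ} {g d : ℝ → ℝ}
    (h : IsProfile g d) :
    AEStronglyMeasurable (energyDensity N lam g d) (volume.restrict (Ioi 0)) := by
  have h1 : AEMeasurable g (volume.restrict (Ioi 0)) :=
    h.acg.continuousOn.aemeasurable measurableSet_Ioi
  have h2 : AEMeasurable d (volume.restrict (Ioi 0)) :=
    h.acd.continuousOn.aemeasurable measurableSet_Ioi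
  have h3 : Measurable (deriv g) := measurable_deriv g
  have h4 : Measurable (deriv d) := measurable_deriv d
  refine AEMeasurable.aestronglyMeasurable ?_
  unfold energyDensity
  fun_prop

/-- Finite energy makes `d g / r` square integrable for `r dr`, so `d g` is small along radii
tending to 0, where `|d| ≥ 1 / 2`. -/
lemma IsProfile.exists_abs_lt_near_zero {N lam : ℝ} {g d : ℝ → ℝ} (h : IsProfile g d) (hN : 1 ≤ N)
    (hlam : 0 < lam) (hint : IntegrableOn (energyDensity N lam g d) (Ioi 0)) {ε δ : ℝ}
    (hε : 0 < ε) (hδ : 0 < δ) : ∃ r, 0 < r ∧ r < δ ∧ |g r| < ε := by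
  have h1 : IntegrableOn (fun r => (d r * g r / r) ^ 2 * r) (Ioi 0) := by
    refine Integrable.mono' hint ?_ ?_
    · have h1 : AEMeasurable g (volume.restrict (Ioi 0)) :=
        h.acg.continuousOn.aemeasurable measurableSet_Ioi
      have h2 : AEMeasurable d (volume.restrict (Ioi 0)) :=
        h.acd.continuousOn.aemeasurable measurableSet_Ioi
      refine AEMeasurable.aestronglyMeasurable ?_
      fun_prop
    · refine (ae_restrict_iff' measurableSet_Ioi).2 (ae_of_all _ fun r hr => ?_)
      have hr0 : 0 < r := hr
      rw [Real.norm_of_nonneg (by positivity)]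
      have e : (d r * g r / r) ^ 2 * r = r * (1 * (d r ^ 2 * g r ^ 2 / r ^ 2)) := by ring
      rw [e, energyDensity]
      have a1 : 1 * (d r ^ 2 * g r ^ 2 / r ^ 2) ≤ N * (d r ^ 2 * g r ^ 2 / r ^ 2) := by gcongr
      have a2 : 0 ≤ N * (deriv d r ^ 2 / r ^ 2) := by positivity
      have a3 : 0 ≤ lam / 4 * (g r ^ 2 - 1) ^ 2 := by positivity
      gcongr
      nlinarith [sq_nonneg (deriv g r)]
  obtain ⟨δ', hδ', h2⟩ := eventually_abs_le_mul h.acd.one_sub h.int_d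
    (by simpa [deriv_const_sub, neg_div] using h.int_dd) (show (0 : ℝ) < 1 / 2 by norm_num)
  obtain ⟨r, hr, hrδ, hr'⟩ := exists_mul_abs_lt_near_zero one_pos
    (h1.mono_set Ioc_subset_Ioi_self) (show 0 < ε / 2 by positivity)
    (lt_min hδ (lt_min hδ' one_pos))
  refine ⟨r, hr, hrδ.trans_le (min_le_left _ _), ?_⟩
  have h3 := h2 r hr (hrδ.trans_le ((min_le_right _ _).trans (min_le_left _ _)))
  have h4 : r < 1 := hrδ.trans_le ((min_le_right _ _).trans (min_le_right _ _))
  rw [abs_div, abs_of_pos hr, mul_div_cancel₀ _ hr.ne', abs_mul] at hr'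
  have h5 : 1 / 2 ≤ |d r| := by
    have := (abs_le.1 h3).2
    exact le_trans (by linarith) (le_abs_self _)
  nlinarith [abs_nonneg (g r)]

/-- At suitable `α` and `β` the amplitudes of both pairs are close to 0 and 1 respectively, so the
`p` parts of the boundary terms nearly cancel. Of the four `K` terms, those of `d` at `β` and of `b`
at `α` have a favourable sign; the other two are small. -/
lemma IsVortex.exists_integral_energyDensity_le {N lam : ℝ} {f b : ℝ → ℝ}
    (hv : IsVortex N lam f b) (hf : LocallyAC f) (hN : 1 ≤ N) (hlam : 0 < lam) {g d : ℝ → ℝ}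
    (h : IsProfile g d) (hint : IntegrableOn (energyDensity N lam g d) (Ioi 0))
    {ε x y : ℝ} (hε : 0 < ε) (hx : 0 < x) (hxy : x ≤ y) :
    ∃ α β, 0 < α ∧ α ≤ x ∧ y ≤ β ∧
      ∫ r in α..β, energyDensity N lam f b r ≤ (∫ r in Ioi 0, energyDensity N lam g d r) + ε := by
  obtain ⟨p, q, K, hc⟩ := hv.exists_isCalibration hN hlam
  set H : ℝ → ℝ := fun t => ∫ x in (0 : ℝ)..t, p |x| with hH
  have hHc : Continuous H :=
    continuous_iff_continuousAt.2 fun t => (hc.hasDerivAt_primitive t).continuousAt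
  have hH0 : H 0 = 0 := intervalIntegral.integral_same
  -- Error budget: four values of `H`, each within `ε / 16` and entering with factor 2, cost `ε /
  -- 2`; each of the two unfavourable `K` terms costs `ε / 4`.
  obtain ⟨η₀, hη₀, h0⟩ := Metric.continuousAt_iff.1 (hHc.continuousAt (x := 0)) (ε / 16)
    (by positivity)
  obtain ⟨η₁, hη₁, h1⟩ := Metric.continuousAt_iff.1 (hHc.continuousAt (x := 1)) (ε / 16)
    (by positivity)
  have h0' : ∀ t, |t| < η₀ → |H t| < ε / 16 := fun t ht => by
    simpa [hH0, Real.dist_eq] using h0 (x := t) (by simpa [Real.dist_eq] using ht)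
  have h1' : ∀ t, |1 - t| < η₁ → |H t - H 1| < ε / 16 := fun t ht => by
    simpa [Real.dist_eq] using h1 (x := t) (by rwa [Real.dist_eq, abs_sub_comm])
  -- the inner radius
  set κ := √(ε / (8 * N)) with hκ
  have hN0 : 0 < N := by linarith
  have hκ0 : 0 < κ := Real.sqrt_pos.2 (by positivity)
  have hκ2 : κ ^ 2 = ε / (8 * N) := Real.sq_sqrt (by positivity)
  obtain ⟨δ₁, hδ₁, hd1⟩ := eventually_abs_le_mul h.acd.one_sub h.int_d
    (by simpa [deriv_const_sub, neg_div] using h.int_dd) hκ0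
  obtain ⟨δ₂, hδ₂, hd2⟩ := hv.tendsto_f_sq_zero hN hlam (η₀ ^ 2) (by positivity)
  obtain ⟨α, hα, hαδ, hgα⟩ := h.exists_abs_lt_near_zero hN hlam hint hη₀
    (lt_min hx (lt_min hδ₁ hδ₂))
  have hαx : α < x := hαδ.trans_le (min_le_left _ _)
  have hα1 : α < δ₁ := hαδ.trans_le ((min_le_right _ _).trans (min_le_left _ _))
  have hα2 : α < δ₂ := hαδ.trans_le ((min_le_right _ _).trans (min_le_right _ _))
  have hfα : |f α| < η₀ := abs_lt_of_sq_lt_sq (hd2 α hα hα2) hη₀.le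
  have hKα : 2 * N * (K (d α) * (α ^ 2)⁻¹) ≤ ε / 4 := by
    have a1 : K (d α) ≤ (κ * α) ^ 2 := by
      refine (hc.K_le _).trans ?_
      rw [← sq_abs]
      have := hd1 α hα hα1
      gcongr
    calc 2 * N * (K (d α) * (α ^ 2)⁻¹) ≤ 2 * N * ((κ * α) ^ 2 * (α ^ 2)⁻¹) := by gcongr
      _ = 2 * N * κ ^ 2 := by field_simp
      _ = ε / 4 := by rw [hκ2]; field_simp; norm_num
  -- the outer radius
  obtain ⟨R₁, hR₁⟩ := eventually_atTop.1 (Metric.tendsto_atTop.1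
    (hv.tendsto_f_atTop hN hlam) η₁ hη₁ |>.elim fun R hR => eventually_atTop.2 ⟨R, hR⟩)
  obtain ⟨β, hβ, hgβ⟩ := exists_mul_abs_lt_at_top h.int_g
    (max (max y R₁) (max 1 (8 * N / ε))) hη₁
  have hβy : y < β := ((le_max_left _ _).trans (le_max_left _ _)).trans_lt hβ
  have hβR : R₁ < β := ((le_max_right _ _).trans (le_max_left _ _)).trans_lt hβ
  have hβ1 : 1 < β := ((le_max_left _ _).trans (le_max_right _ _)).trans_lt hβ
  have hβN : 8 * N / ε < β := ((le_max_right _ _).trans (le_max_right _ _)).trans_lt hβ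
  have hgβ' : |1 - g β| < η₁ := by nlinarith [abs_nonneg (1 - g β)]
  have hfβ : |1 - f β| < η₁ := by
    have := hR₁ β hβR.le
    rwa [Real.dist_eq, abs_sub_comm] at this
  have hKβ : 2 * N * (K (b β) * (β ^ 2)⁻¹) ≤ ε / 4 := by
    have hβ0 : 0 < β := one_pos.trans hβ1
    calc 2 * N * (K (b β) * (β ^ 2)⁻¹) ≤ 2 * N * (1 * (β ^ 2)⁻¹) := by
          gcongr; exact hc.K_le_one _
      _ = 2 * N / β ^ 2 := by ring
      _ ≤ ε / 4 := by
        rw [div_lt_iff₀ hε] at hβN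
        rw [div_le_div_iff₀ (by positivity) (by norm_num)]
        nlinarith [mul_pos hε hβ0]
  have hαβ : α ≤ β := hαx.le.trans (hxy.trans hβy.le)
  refine ⟨α, β, hα, hαx.le, hβy.le, ?_⟩
  have hsub : Ioc α β ⊆ Ioi 0 := fun r hr => hα.trans hr.1
  have key := hv.integral_energyDensity_le hf hN hlam hc h.acg h.acd hα hαβ
    ((intervalIntegrable_iff_integrableOn_Ioc_of_le hαβ).2 (hint.mono_set hsub))
  have hle : ∫ r in α..β, energyDensity N lam g d r ≤ ∫ r in Ioi 0, energyDensity N lam g d r := by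
    rw [intervalIntegral.integral_of_le hαβ]
    refine setIntegral_mono_set hint ?_ hsub.eventuallyLE
    exact (ae_restrict_iff' measurableSet_Ioi).2
      (ae_of_all _ fun r hr => energyDensity_nonneg hN0.le hlam g d hr)
  have b1 := abs_lt.1 (h0' _ hgα)
  have b2 := abs_lt.1 (h0' _ hfα)
  have b3 := abs_lt.1 (h1' _ hgβ')
  have b4 := abs_lt.1 (h1' _ hfβ)
  have b5 : 0 ≤ 2 * N * (K (d β) * (β ^ 2)⁻¹) := by have := hc.K_nonneg (d β); positivity
  have b6 : 0 ≤ 2 * N * (K (b α) * (α ^ 2)⁻¹) := by have := hc.K_nonneg (b α); positivity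
  have e1 : ∀ g d : ℝ → ℝ, ∀ r, nullLagrangian N p K g d r
      = 2 * H (g r) + 2 * N * (K (d r) * (r ^ 2)⁻¹) := fun _ _ _ => rfl
  simp only [e1] at key
  linarith [b1.1, b1.2, b2.1, b2.2, b3.1, b3.2, b4.1, b4.2]

/-- Only competitors of finite energy matter. Exhausting by annuli bounds the vortex energy without
assuming beforehand that it is finite. -/
lemma IsVortex.lintegral_energyDensity_le {N lam : ℝ} {f b : ℝ → ℝ}
    (hv : IsVortex N lam f b) (hf : LocallyAC f) (hN : 1 ≤ N) (hlam : 0 < lam) {g d : ℝ → ℝ}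
    (h : IsProfile g d) :
    ∫⁻ r in Ioi 0, ENNReal.ofReal (energyDensity N lam f b r)
      ≤ ∫⁻ r in Ioi 0, ENNReal.ofReal (energyDensity N lam g d r) := by
  have hN0 : 0 ≤ N := by linarith
  by_cases htop : ∫⁻ r in Ioi 0, ENNReal.ofReal (energyDensity N lam g d r) = ∞
  · rw [htop]; exact le_top
  have hnn : ∀ g d : ℝ → ℝ, 0 ≤ᵐ[volume.restrict (Ioi 0)] energyDensity N lam g d := fun g d =>
    (ae_restrict_iff' measurableSet_Ioi).2
      (ae_of_all _ fun r hr => energyDensity_nonneg hN0 hlam g d hr)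
  have hint : IntegrableOn (energyDensity N lam g d) (Ioi 0) :=
    ⟨h.aestronglyMeasurable_energyDensity,
      (hasFiniteIntegral_iff_ofReal (hnn g d)).2 (lt_top_iff_ne_top.2 htop)⟩
  rw [← ofReal_integral_eq_lintegral_ofReal hint (hnn g d)]
  have hU : Ioi (0 : ℝ) = ⋃ n : ℕ, Ioc ((n : ℝ) + 1)⁻¹ (n + 1) := by
    ext r
    simp only [mem_Ioi, mem_iUnion, mem_Ioc]
    constructor
    · intro hr
      obtain ⟨n, hn⟩ := exists_nat_gt (max r r⁻¹)
      have h1 : r < n := (le_max_left _ _).trans_lt hn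
      have h2 : r⁻¹ < (n : ℝ) + 1 := ((le_max_right _ _).trans_lt hn).trans (by linarith)
      exact ⟨n, inv_lt_of_inv_lt₀ hr h2, by linarith⟩
    · rintro ⟨n, hn, -⟩
      exact lt_trans (by positivity) hn
  have hdir : Directed (· ⊆ ·) fun n : ℕ => Ioc ((n : ℝ) + 1)⁻¹ (n + 1) := by
    refine Monotone.directed_le fun m n hmn => ?_
    have : (m : ℝ) ≤ n := by exact_mod_cast hmn
    exact Ioc_subset_Ioc (by gcongr) (by gcongr)
  conv_lhs => rw [hU]
  rw [setLIntegral_iUnion_of_directed _ hdir]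
  refine iSup_le fun n => ENNReal.le_of_forall_pos_le_add fun ε hε _ => ?_
  have hn1 : (1 : ℝ) ≤ (n : ℝ) + 1 := by have := n.cast_nonneg (α := ℝ); linarith
  obtain ⟨α, β, hα, hαn, hβn, hle⟩ := hv.exists_integral_energyDensity_le hf hN hlam h hint
    (x := ((n : ℝ) + 1)⁻¹) (y := n + 1) (NNReal.coe_pos.2 hε) (by positivity)
    ((inv_le_one_of_one_le₀ hn1).trans hn1)
  have hαβ : α ≤ β := hαn.trans (((inv_le_one_of_one_le₀ hn1).trans hn1).trans hβn)
  have hsub : Ioc α β ⊆ Ioi 0 := fun r hr => hα.trans hr.1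
  have hif : IntegrableOn (energyDensity N lam f b) (Ioc α β) := by
    refine ((hv.continuousOn_energyDensity.mono ?_).integrableOn_Icc).mono_set Ioc_subset_Icc_self
    exact fun r hr => hα.trans_le hr.1
  calc ∫⁻ r in Ioc ((n : ℝ) + 1)⁻¹ (n + 1), ENNReal.ofReal (energyDensity N lam f b r)
      ≤ ∫⁻ r in Ioc α β, ENNReal.ofReal (energyDensity N lam f b r) :=
        lintegral_mono_set (Ioc_subset_Ioc hαn hβn)
    _ = ENNReal.ofReal (∫ r in Ioc α β, energyDensity N lam f b r) :=
        (ofReal_integral_eq_lintegral_ofReal hif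
          (ae_restrict_of_ae_restrict_of_subset hsub (hnn f b))).symm
    _ ≤ ENNReal.ofReal ((∫ r in Ioi 0, energyDensity N lam g d r) + ε) := by
        rw [← intervalIntegral.integral_of_le hαβ]
        exact ENNReal.ofReal_le_ofReal hle
    _ ≤ ENNReal.ofReal (∫ r in Ioi 0, energyDensity N lam g d r) + ε := by
        refine ENNReal.ofReal_add_le.trans ?_
        rw [ENNReal.ofReal_coe_nnreal]

/-! ### The case without winding, and the conclusion. -/

/-- Without winding, a vortex profile satisfies `f² = 1`, by the Pohozaev identity. -/
lemma IsVortex.f_sq_eq_one {lam : ℝ} {f b : ℝ → ℝ} (h : IsVortex 0 lam f b) (hlam : 0 < lam)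
    {r : ℝ} (hr : 0 < r) : f r ^ 2 = 1 := by
  set e : ℝ → ℝ := fun r => (r * deriv f r) ^ 2 / 2 - lam / 8 * (f r ^ 2 - 1) ^ 2 * r ^ 2 with he
  have hd : ∀ r ∈ Ioi (0 : ℝ), HasDerivAt e (-(lam / 4 * (f r ^ 2 - 1) ^ 2 * r)) r := by
    intro r hr
    refine ((((h.hasDerivAt_mul_deriv_f hr).pow 2).div_const 2).sub
      ((((((h.df r hr).pow 2).sub_const 1).pow 2).const_mul (lam / 8)).mul
        ((hasDerivAt_id r).pow 2))).congr_deriv ?_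
    simp
    ring
  have hanti : AntitoneOn e (Ioi 0) :=
    antitoneOn_of_hasDerivAt_nonpos (convex_Ioi 0) hd fun r hr => by
      have hr0 : 0 < r := hr
      have : 0 ≤ lam / 4 * (f r ^ 2 - 1) ^ 2 * r := by positivity
      linarith
  -- The nonincreasing `e` is bounded above through small radii where `r f'` is small, and below
  -- through large radii where `r (1 - f)` is small. Hence `e` vanishes identically, and so does its
  -- derivative.
  have hle : ∀ r, 0 < r → e r ≤ 0 := by
    intro r hr
    refine le_of_forall_pos_le_add fun ε hε => ?_
    obtain ⟨s, hs, hsr, hs'⟩ := exists_mul_abs_lt_near_zero one_pos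
      (h.int_df.mono_set Ioc_subset_Ioi_self) (Real.sqrt_pos.2 hε) hr
    have h1 : e r ≤ e s := hanti hs hr hsr.le
    have h2 : (s * deriv f s) ^ 2 < ε := by
      rw [← sq_abs, abs_mul, abs_of_pos hs, ← Real.sq_sqrt hε.le]
      gcongr
    have h3 : 0 ≤ lam / 8 * (f s ^ 2 - 1) ^ 2 * s ^ 2 := by positivity
    have h4 : e s = (s * deriv f s) ^ 2 / 2 - lam / 8 * (f s ^ 2 - 1) ^ 2 * s ^ 2 := rfl
    linarith [sq_nonneg (s * deriv f s)]
  have hge : ∀ r, 0 < r → 0 ≤ e r := by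
    intro r hr
    refine le_of_forall_pos_le_add fun ε hε => ?_
    set θ := min 1 (ε / (2 * lam)) with hθ
    have hθ0 : 0 < θ := lt_min one_pos (by positivity)
    have hθ1 : θ ≤ 1 := min_le_left _ _
    have hθ2 : lam * θ ≤ ε / 2 := by
      have : θ ≤ ε / (2 * lam) := min_le_right _ _
      rw [le_div_iff₀ (by positivity)] at this
      linarith
    obtain ⟨s, hs, hs'⟩ := exists_mul_abs_lt_at_top h.int_f (max r 1) hθ0
    have hsr : r < s := (le_max_left _ _).trans_lt hs
    have hs1 : 1 < s := (le_max_right _ _).trans_lt hs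
    have h1 : e s ≤ e r := hanti hr (hr.trans hsr) hsr.le
    have h2 : |1 - f s| < θ := by nlinarith [abs_nonneg (1 - f s)]
    have h3 : |1 + f s| ≤ 3 := by rw [abs_lt] at h2; rw [abs_le]; constructor <;> linarith
    have h4 : (f s ^ 2 - 1) ^ 2 * s ^ 2 = ((s * |1 - f s|) * |1 + f s|) ^ 2 := by
      rw [mul_pow, mul_pow, sq_abs, sq_abs]; ring
    have h5 : ((s * |1 - f s|) * |1 + f s|) ^ 2 ≤ (θ * 3) ^ 2 := by gcongr
    have h6 : lam / 8 * ((f s ^ 2 - 1) ^ 2 * s ^ 2) ≤ lam / 8 * (θ * 3) ^ 2 := by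
      rw [h4]; gcongr
    have h7 : lam / 8 * (θ * 3) ^ 2 ≤ 9 / 8 * (lam * θ) := by
      have := mul_pos hlam hθ0
      nlinarith
    have h8 : e s = (s * deriv f s) ^ 2 / 2 - lam / 8 * (f s ^ 2 - 1) ^ 2 * s ^ 2 := rfl
    linarith [sq_nonneg (s * deriv f s)]
  have h0 : HasDerivAt e 0 r := by
    refine (hasDerivAt_const r (0 : ℝ)).congr_of_eventuallyEq ?_
    filter_upwards [Ioi_mem_nhds hr] with s hs using le_antisymm (hle s hs) (hge s hs)
  have h1 := h0.unique (hd r hr)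
  have h2 : (f r ^ 2 - 1) ^ 2 = 0 := by
    have h3 : lam / 4 * (f r ^ 2 - 1) ^ 2 * r = 0 := by linarith
    simpa [hr.ne', hlam.ne'] using h3
  have := pow_eq_zero_iff (two_ne_zero) |>.1 h2
  linarith

lemma IsVortex.energyDensity_eq_zero {lam : ℝ} {f b : ℝ → ℝ} (h : IsVortex 0 lam f b)
    (hlam : 0 < lam) {r : ℝ} (hr : 0 < r) : energyDensity 0 lam f b r = 0 := by
  have h1 := h.f_sq_eq_one hlam hr
  have h0 : HasDerivAt (fun r => f r ^ 2) 0 r := by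
    refine (hasDerivAt_const r (1 : ℝ)).congr_of_eventuallyEq ?_
    filter_upwards [Ioi_mem_nhds hr] with s hs using h.f_sq_eq_one hlam hs
  have h2 := h0.unique ((h.df r hr).pow 2)
  have hf : f r ≠ 0 := by intro hf; rw [hf] at h1; norm_num at h1
  have h3 : deriv f r = 0 := by simpa [hf] using h2.symm
  simp [energyDensity, h1, h3]

end GinzburgLandau
end

/-- If `lam ≥ 2 n²`, every solution of the radial vortex equations in the class in which the radial
energy is considered minimizes the radial energy over that class. -/
theorem mainTheorem8 (n : ℤ) (lam : ℝ) (hlam : 0 < lam) (hn : 2 * (n : ℝ) ^ 2 ≤ lam)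
    (f a : ℝ → ℝ) (hmem : (f, a) ∈ GinzburgLandau.radialClass)
    (hsol : GinzburgLandau.SolvesVortexODE n lam f a) :
    IsMinOn (fun u : (ℝ → ℝ) × (ℝ → ℝ) => GinzburgLandau.radialEnergy n lam u.1 u.2)
      GinzburgLandau.radialClass (f, a) := by
  rw [isMinOn_iff]
  rintro ⟨g, c⟩ hgc
  have hv := GinzburgLandau.isVortex_of_solves hmem hsol
  simp only [GinzburgLandau.radialEnergy_eq]
  refine mul_le_mul_right ?_ _
  by_cases h0 : n = 0
  · subst h0
    have hv0 : GinzburgLandau.IsVortex 0 lam f fun r => 1 - a r := by simpa using hv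
    refine le_of_eq_of_le ?_ zero_le
    refine (setLIntegral_congr_fun measurableSet_Ioi fun r hr => ?_).trans lintegral_zero
    have := hv0.energyDensity_eq_zero hlam hr
    simp [this]
  · refine hv.lintegral_energyDensity_le (GinzburgLandau.isProfile_of_mem hmem).acg ?_ hlam
      (GinzburgLandau.isProfile_of_mem hgc)
    have : (1 : ℤ) ≤ n ^ 2 := Int.one_le_abs h0 |>.trans (by nlinarith [sq_abs n, Int.one_le_abs h0])
    exact_mod_cast this
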